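/- Let $X$ be a locally compact, second countable, metrizable space with its Borel $\sigma$-algebra. An equivalence relation on a topological space is called *proper* if the quotient space is Hausdorff and the quotient map is a local homeomorphism. Let $U_n\subseteq X$ ($n\in\mathbb N=\{0,1,2,\dots\}$) be open sets with $X=U_0\supseteq U_1\supseteq U_2\supseteq\cdots$, and for each $n$ let $R_n$ be a proper equivalence relation on $U_n$, such that $R_0$ is the identity relation on $X$ and $R_n\cap(U_n\times U_m)\subseteq R_m$ whenever $n\le m$. Then $R=\bigcup_n R_n$ is an equivalence relation on $X$; equip it with the inductive limit topology, in which $A\subseteq R$ is open if and only if $A\cap R_n$ is open in $R_n$ (with the topology induced from $X\times X$) for every $n$. For $n\ge1$ let $k_n:U_n\to\mathbb R$ be continuous functions with $k_n(x)=k_n(y)$ whenever $(x,y)\in R_{n-1}\cap(U_n\times U_n)$. Put $h_0=0$ and $h_n=h_{n-1}|_{U_n}+k_n$ on $U_n$ for $n\ge 1$, and let $D:R\to(0,\infty)$ be given by $D(x,y)=e^{h_n(x)-h_n(y)}$ for $(x,y)\in R_n$ (this does not depend on the choice of $n$). A measure $\mu$ on $X$ is called *$D$-quasi-invariant* if $$\int_X\sum_{y:(x,y)\in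 R}f(x,y)\,d\mu(x)=\int_X\sum_{x:(x,y)\in R}f(x,y)\,D(x,y)\,d\mu(y)$$ for every continuous compactly supported $f:R\to\mathbb C$. For $n\in\mathbb N$ let $\rho_n=e^{h_n}$ and $\zeta_n(x)=\sum_{y:(x,y)\in R_n}\rho_n(y)\in(0,\infty]$ for $x\in U_n$, and let $Z_n=\{x\in U_n:\zeta_n(x)=\infty\}$. For a Borel function $f:X\to[0,\infty]$ set $$Q_n(f)(x)=\sum_{y:(x,y)\in R_n}f(y)\,\rho_n(y)\,\zeta_n(y)^{-1}\ \text{ if }x\in U_n,\qquad Q_n(f)(x)=0\ \text{ otherwise},$$ with the conventions $\infty^{-1}=0$ and $0\cdot\infty=0$; for a measure $\nu$ on $X$ let $Q_n^*(\nu)$ be the Borel measure such that $\int_X f\,dQ_n^*(\nu)=\int_X Q_n(f)\,d\nu$ for all Borel $f:X\to[0,\infty]$. Let $Z=\bigcup_{n\in\mathbb N}Z_n$, $W_k=(U_k\setminus U_{k+1})\setminus Z$ for $k\in\mathbb N$, and $W_\infty=\bigl(\bigcap_{n\in\mathbb N}U_n\bigr)\setminus Z$. Let $\mu$ be a finite Borel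 measure on $X$, and put $\mu_k=1_{W_k}\mu$ for $k\in\mathbb N\cup\{\infty\}$, that is, $\mu_k(A)=\mu(A\cap W_k)$. **Theorem 7.4.** The measure $\mu$ is $D$-quasi-invariant if and only if all of the following hold: (i) $\mu(Z)=0$; (ii) $Q_k^*(\mu_k)=\mu_k$ for every integer $k\ge1$; (iii) $Q_i^*(\mu_\infty)=\mu_\infty$ for every integer $i\ge1$. -/

import Mathlib

open MeasureTheory Set Topology
open scoped ENNReal

noncomputable section

/-! ### Proper equivalence relations -/

namespace ProperRel

variable {Y : Type*}

/-- An equivalence relation is proper if its quotient space is Hausdorff and its quotient map is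
a local homeomorphism. -/
def IsProper [TopologicalSpace Y] (s : Setoid Y) : Prop :=
  T2Space (Quotient s) ∧ IsLocalHomeomorph (Quotient.mk s)

/-- The operator `E`, summing a `[0, ∞]`-valued function over the equivalence classes. -/
def classSum (s : Setoid Y) (f : Y → ℝ≥0∞) (x : Y) : ℝ≥0∞ :=
  ∑' y : {y : Y // s x y}, f y

/-- The partition function `ζ = E(ρ)` of `ρ`. -/
def partitionFn (s : Setoid Y) (ρ : Y → ℝ≥0∞) : Y → ℝ≥0∞ :=
  classSum s ρ

/-- The operator `P_ρ(f) = E(f ρ ζ⁻¹)`, with the conventions `∞⁻¹ = 0` and `0 * ∞ = 0`. -/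
def condExpOp (s : Setoid Y) (ρ f : Y → ℝ≥0∞) : Y → ℝ≥0∞ :=
  classSum s (fun y => f y * ρ y * (partitionFn s ρ y)⁻¹)

theorem classSum_tsum (s : Setoid Y) (f : ℕ → Y → ℝ≥0∞) (x : Y) :
    classSum s (fun y => ∑' i, f i y) x = ∑' i, classSum s (f i) x := by
  unfold classSum
  exact ENNReal.tsum_comm

theorem classSum_iSup (s : Setoid Y) (f : ℕ → Y → ℝ≥0∞) (hf : Monotone f) (x : Y) :
    classSum s (fun y => ⨆ i, f i y) x = ⨆ i, classSum s (f i) x := by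
  unfold classSum
  let _ : MeasurableSpace {y : Y // s x y} := ⊤
  simp only [← lintegral_count]
  rw [lintegral_iSup]
  · intro i
    exact measurable_from_top
  · intro i j hij y
    exact hf hij y

theorem measurable_classSum [TopologicalSpace Y] [SecondCountableTopology Y] [MeasurableSpace Y]
    [BorelSpace Y] {s : Setoid Y} (hs : IsProper s) {f : Y → ℝ≥0∞} (hf : Measurable f) :
    Measurable (classSum s f) := by
  rcases isEmpty_or_nonempty Y with hY | hY
  · exact measurable_of_empty _
  choose e he1 he2 using hs.2
  obtain ⟨S, hSc, hS⟩ := TopologicalSpace.countable_cover_nhds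
    (f := fun x => (e x).source) (fun x => (e x).open_source.mem_nhds (he1 x))
  have hSne : S.Nonempty := by
    rcases S.eq_empty_or_nonempty with h | h
    · rw [h] at hS
      obtain ⟨y⟩ := hY
      have : y ∈ (univ : Set Y) := mem_univ y
      rw [← hS] at this
      simp at this
    · exact h
  obtain ⟨u, hu⟩ := hSc.exists_eq_range hSne
  set W : ℕ → Set Y := fun i => (e (u i)).source with hW
  have hWcov : ⋃ i, W i = univ := by
    rw [← hS, hu]
    simp [hW]
  have hBm : ∀ i, MeasurableSet (disjointed W i) :=
    MeasurableSet.disjointed (fun i => (e (u i)).open_source.measurableSet)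
  have hBsub : ∀ i, disjointed W i ⊆ W i := fun i => disjointed_subset W i
  have hBcov : ∀ y, ∃ i, y ∈ disjointed W i := by
    intro y
    have : y ∈ ⋃ i, disjointed W i := by
      rw [iUnion_disjointed, hWcov]
      exact mem_univ y
    exact mem_iUnion.1 this
  have hsplit : f = fun y => ∑' i, (disjointed W i).indicator f y := by
    funext y
    obtain ⟨i, hi⟩ := hBcov y
    rw [tsum_eq_single i, indicator_of_mem hi]
    intro j hj
    refine indicator_of_notMem (fun hjy => ?_) _
    exact (Set.disjoint_left.1 (disjoint_disjointed W hj)) hjy hi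
  have hE : classSum s f = fun x => ∑' i, classSum s ((disjointed W i).indicator f) x := by
    funext x
    conv_lhs => rw [hsplit]
    exact classSum_tsum s _ x
  rw [hE]
  refine Measurable.tsum (fun i => ?_)
  set g := (disjointed W i).indicator f with hg
  have hgm : Measurable g := hf.indicator (hBm i)
  set p : OpenPartialHomeomorph Y (Quotient s) := e (u i) with hp
  have hpe : Quotient.mk s = p := he2 (u i)
  have hcont : Continuous (Quotient.mk s) := hs.2.continuous
  have hopen : IsOpen (Quotient.mk s ⁻¹' p.target) := p.open_target.preimage hcont
  refine measurable_of_restrict_of_restrict_compl hopen.measurableSet ?_ ?_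
  · have heq : (Quotient.mk s ⁻¹' p.target).domRestrict (classSum s g) =
        fun x : (Quotient.mk s ⁻¹' p.target : Set Y) =>
          g (p.symm (Quotient.mk s (x : Y))) := by
      funext x
      obtain ⟨x, hx⟩ := x
      have hq : p (p.symm (Quotient.mk s x)) = Quotient.mk s x := p.right_inv hx
      have hrel : s x (p.symm (Quotient.mk s x)) := by
        rw [← hpe] at hq
        exact Setoid.symm (Quotient.exact hq)
      simp only [domRestrict_apply]
      unfold classSum
      rw [tsum_eq_single (⟨p.symm (Quotient.mk s x), hrel⟩ : {y : Y // s x y})]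
      rintro ⟨y, hy⟩ hne
      refine indicator_of_notMem (fun hyB => hne ?_) _
      have hyW : y ∈ p.source := hBsub i hyB
      have h1 : p y = Quotient.mk s x := by
        rw [← hpe]
        exact Quotient.sound (Setoid.symm hy)
      have h2 : p.symm (Quotient.mk s x) = y := by
        rw [← h1]
        exact p.left_inv hyW
      exact Subtype.ext h2.symm
    rw [heq]
    refine hgm.comp (Continuous.measurable ?_)
    exact p.continuousOn_symm.comp_continuous (hcont.comp continuous_subtype_val) (fun x => x.2)
  · have heq : (Quotient.mk s ⁻¹' p.target)ᶜ.domRestrict (classSum s g) = fun _ => 0 := by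
      funext x
      obtain ⟨x, hx⟩ := x
      simp only [domRestrict_apply]
      unfold classSum
      rw [ENNReal.tsum_eq_zero]
      rintro ⟨y, hy⟩
      refine indicator_of_notMem (fun hyB => hx ?_) _
      have hyW : y ∈ p.source := hBsub i hyB
      have h1 : p y = Quotient.mk s x := by
        rw [← hpe]
        exact Quotient.sound (Setoid.symm hy)
      change Quotient.mk s x ∈ p.target
      rw [← h1]
      exact p.map_source hyW
    rw [heq]
    exact measurable_const

end ProperRel

open ProperRel

/-! ### Generalized approximately proper equivalence relations -/

/-- A generalized approximately proper equivalence relation on `X`: a decreasing sequence of open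
sets `U n` with `U 0 = X`, and proper equivalence relations `R n` on `U n` with `R 0` the identity
relation, such that `R n ∩ (U n × U m) ⊆ R m` whenever `n ≤ m`. -/
structure GAP (X : Type*) [TopologicalSpace X] where
  U : ℕ → Set X
  R : (n : ℕ) → Setoid (U n)
  isOpen_U : ∀ n, IsOpen (U n)
  isProper_R : ∀ n, IsProper (R n)
  U_zero : U 0 = univ
  U_succ_subset : ∀ n, U (n + 1) ⊆ U n
  R_zero : ∀ x y : U 0, R 0 x y ↔ x = y
  compat : ∀ n m, n ≤ m → ∀ x y : U n, R n x y → ∀ hy : (y : X) ∈ U m,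
    ∃ hx : (x : X) ∈ U m, R m ⟨x, hx⟩ ⟨y, hy⟩

namespace GAP

variable {X : Type*} [TopologicalSpace X]

/-- The relation `R n`, viewed as a relation on `X`. -/
def relOn (G : GAP X) (n : ℕ) (x y : X) : Prop :=
  ∃ (hx : x ∈ G.U n) (hy : y ∈ G.U n), G.R n ⟨x, hx⟩ ⟨y, hy⟩

theorem relOn_symm (G : GAP X) {n : ℕ} {x y : X} (h : G.relOn n x y) : G.relOn n y x := by
  obtain ⟨hx, hy, h⟩ := h
  exact ⟨hy, hx, (G.R n).symm h⟩

theorem relOn_trans (G : GAP X) {n : ℕ} {x y z : X} (h : G.relOn n x y) (h' : G.relOn n y z) :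
    G.relOn n x z := by
  obtain ⟨hx, hy, h⟩ := h
  obtain ⟨_, hz, h'⟩ := h'
  exact ⟨hx, hz, (G.R n).trans h h'⟩

theorem relOn_of_le (G : GAP X) {n m : ℕ} (hnm : n ≤ m) {x y : X} (h : G.relOn n x y)
    (hy : y ∈ G.U m) : G.relOn m x y := by
  obtain ⟨hx, hy', h⟩ := h
  obtain ⟨hx', h'⟩ := G.compat n m hnm ⟨x, hx⟩ ⟨y, hy'⟩ h hy
  exact ⟨hx', hy, h'⟩

/-- The equivalence relation `R = ⋃ n, R n` on `X`. -/
def rel (G : GAP X) : Setoid X where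
  r x y := ∃ n, G.relOn n x y
  iseqv := by
    refine ⟨fun x => ?_, ?_, ?_⟩
    · have hx : x ∈ G.U 0 := by
        rw [G.U_zero]
        exact mem_univ x
      exact ⟨0, hx, hx, (G.R 0).refl _⟩
    · rintro x y ⟨n, h⟩
      exact ⟨n, G.relOn_symm h⟩
    · rintro x y z ⟨n, h⟩ ⟨m, h'⟩
      rcases le_total n m with hnm | hnm
      · exact ⟨m, G.relOn_trans (G.relOn_of_le hnm h h'.1) h'⟩
      · exact ⟨n, G.relOn_trans h (G.relOn_symm (G.relOn_of_le hnm (G.relOn_symm h') h.2.1))⟩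

/-- The groupoid `R = ⋃ n, R n`, as a set of pairs. -/
def Groupoid (G : GAP X) : Type _ := {p : X × X // G.rel p.1 p.2}

/-- The range map `r(x, y) = x`. -/
def Groupoid.range {G : GAP X} (γ : G.Groupoid) : X := γ.1.1

/-- The source map `s(x, y) = y`. -/
def Groupoid.source {G : GAP X} (γ : G.Groupoid) : X := γ.1.2

/-- The inclusion of `R n`, as a set of pairs, in `R`. -/
def inclusion (G : GAP X) (n : ℕ) (p : {p : X × X // G.relOn n p.1 p.2}) : G.Groupoid :=
  ⟨p.1, n, p.2⟩

/-- The inductive limit topology on `R`: a set is open iff its intersection with each `R n` is open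
in `R n`, where `R n` carries the topology induced by `X × X`. -/
instance (G : GAP X) : TopologicalSpace G.Groupoid :=
  ⨆ n, TopologicalSpace.coinduced (G.inclusion n) inferInstance

/-- A potential: continuous functions `k_n : U n → ℝ` for `n ≥ 1`, such that `k_n(x) = k_n(y)`
whenever `x, y ∈ U n` are equivalent under `R (n - 1)`. Here `k n` stands for `k_{n+1}`. -/
structure Potential (G : GAP X) where
  k : (n : ℕ) → G.U (n + 1) → ℝ
  continuous_k : ∀ n, Continuous (k n)
  invariant : ∀ n (x y : G.U (n + 1)), G.relOn n x y → k n x = k n y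

namespace Potential

variable {G : GAP X} (K : G.Potential)

/-- `h_0 = 0` and `h_{n+1} = h_n + k_{n+1}` on `U (n + 1)`. -/
def h (K : G.Potential) : (n : ℕ) → G.U n → ℝ
  | 0 => fun _ => 0
  | n + 1 => fun x => h K n ⟨x, G.U_succ_subset n x.2⟩ + K.k n x

theorem continuous_h (n : ℕ) : Continuous (K.h n) := by
  induction n with
  | zero => exact continuous_const
  | succ n ih =>
    exact (ih.comp (continuous_subtype_val.subtype_mk _)).add (K.continuous_k n)

/-- The cocycle `c` on `R`, given by `c(x, y) = h_n(x) - h_n(y)` for any `n` such that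
`(x, y) ∈ R n`; see `cocycle_eq` for the independence of `n`. -/
def cocycle (γ : G.Groupoid) : ℝ :=
  K.h γ.2.choose ⟨γ.range, γ.2.choose_spec.1⟩ - K.h γ.2.choose ⟨γ.source, γ.2.choose_spec.2.1⟩

theorem h_sub_h_eq {n m : ℕ} (hnm : n ≤ m) {x y : X} (hn : G.relOn n x y) (hm : G.relOn m x y) :
    K.h n ⟨x, hn.1⟩ - K.h n ⟨y, hn.2.1⟩ = K.h m ⟨x, hm.1⟩ - K.h m ⟨y, hm.2.1⟩ := by
  induction m, hnm using Nat.le_induction with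
  | base => rfl
  | succ m hnm ih =>
    have hm' : G.relOn m x y := G.relOn_of_le hnm hn (G.U_succ_subset m hm.2.1)
    rw [ih hm']
    have hk : K.k m ⟨x, hm.1⟩ = K.k m ⟨y, hm.2.1⟩ := K.invariant m _ _ hm'
    simp only [h, hk]
    ring

theorem cocycle_eq (γ : G.Groupoid) (n : ℕ) (hn : G.relOn n γ.range γ.source) :
    K.cocycle γ = K.h n ⟨γ.range, hn.1⟩ - K.h n ⟨γ.source, hn.2.1⟩ := by
  unfold cocycle
  rcases le_total n γ.2.choose with h | h
  · exact (K.h_sub_h_eq h hn γ.2.choose_spec).symm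
  · exact K.h_sub_h_eq h γ.2.choose_spec hn

/-- The multiplicative cocycle `D = e^c` on `R`. -/
def D (γ : G.Groupoid) : ℝ := Real.exp (K.cocycle γ)

/-- A measure on `X` (the unit space of `R`) is `D`-quasi-invariant if
`∫ ∑_{r(γ) = x} f(γ) dμ(x) = ∫ ∑_{s(γ) = x} f(γ) D(γ) dμ(x)` for all `f ∈ C_c(R)`.
The sums have finitely many nonzero terms, since `R` is a Hausdorff étale groupoid. -/
def IsQuasiInvariant [MeasurableSpace X] (μ : Measure X) : Prop :=
  ∀ f : G.Groupoid → ℂ, Continuous f → HasCompactSupport f →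
    ∫ x, ∑' γ : {γ : G.Groupoid // γ.range = x}, f γ ∂μ =
      ∫ x, ∑' γ : {γ : G.Groupoid // γ.source = x}, f γ * (K.D γ : ℂ) ∂μ

/-- `ρ_n = e^{h_n}`, as a `[0, ∞]`-valued function on `U n`. -/
def rho (n : ℕ) (x : G.U n) : ℝ≥0∞ := ENNReal.ofReal (Real.exp (K.h n x))

/-- The partition function `ζ_n` of `ρ_n` on `U n`. -/
def zeta (n : ℕ) : G.U n → ℝ≥0∞ := partitionFn (G.R n) (K.rho n)

/-- `Z_n`, the set of points of `U n` at which `ζ_n` is infinite. -/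
def Z (n : ℕ) : Set X := {x | ∃ hx : x ∈ G.U n, K.zeta n ⟨x, hx⟩ = ∞}

/-- `Z = ⋃ n, Z_n`. -/
def ZUnion : Set X := ⋃ n, K.Z n

/-- `W_n = (U n \ U (n + 1)) \ Z`. -/
def W (n : ℕ) : Set X := (G.U n \ G.U (n + 1)) \ K.ZUnion

/-- `W_∞ = (⋂ n, U n) \ Z`. -/
def WInf : Set X := (⋂ n, G.U n) \ K.ZUnion

open Classical in
/-- The operator `Q_n`: `Q_n(f)(x) = ∑_{y ∈ R_n(x)} f(y) ρ_n(y) ζ_n(y)⁻¹` if `x ∈ U n`, and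
`Q_n(f)(x) = 0` otherwise. -/
def Q (n : ℕ) (f : X → ℝ≥0∞) (x : X) : ℝ≥0∞ :=
  if hx : x ∈ G.U n then condExpOp (G.R n) (K.rho n) (fun y => f y) ⟨x, hx⟩ else 0

theorem Q_tsum (n : ℕ) (f : ℕ → X → ℝ≥0∞) (x : X) :
    K.Q n (fun y => ∑' i, f i y) x = ∑' i, K.Q n (f i) x := by
  unfold Q
  split_ifs with hx
  · unfold condExpOp
    simp only [← ENNReal.tsum_mul_right]
    exact classSum_tsum _ _ _
  · simp

variable [SecondCountableTopology X] [MeasurableSpace X] [BorelSpace X]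

theorem measurable_Q (n : ℕ) {f : X → ℝ≥0∞} (hf : Measurable f) : Measurable (K.Q n f) := by
  classical
  have hρ : Measurable (K.rho n) :=
    (Real.measurable_exp.comp (K.continuous_h n).measurable).ennreal_ofReal
  have hE : Measurable (condExpOp (G.R n) (K.rho n) (fun y => f y)) := by
    refine measurable_classSum (G.isProper_R n) ?_
    exact ((hf.comp measurable_subtype_coe).mul hρ).mul
      (measurable_classSum (G.isProper_R n) hρ).inv
  exact Measurable.dite (s := G.U n) hE measurable_const (G.isOpen_U n).measurableSet

theorem measurableSet_ZUnion : MeasurableSet K.ZUnion := by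
  refine MeasurableSet.iUnion (fun n => ?_)
  have hρ : Measurable (K.rho n) :=
    (Real.measurable_exp.comp (K.continuous_h n).measurable).ennreal_ofReal
  have hζ : MeasurableSet {x : G.U n | K.zeta n x = ∞} :=
    measurable_classSum (G.isProper_R n) hρ (measurableSet_singleton ∞)
  have hZ : K.Z n = (fun x : G.U n => (x : X)) '' {x : G.U n | K.zeta n x = ∞} := by
    ext x
    constructor
    · rintro ⟨hx, h⟩
      exact ⟨⟨x, hx⟩, h, rfl⟩
    · rintro ⟨y, h, rfl⟩
      exact ⟨y.2, h⟩
  rw [hZ]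
  exact (G.isOpen_U n).measurableSet.subtype_image hζ

/-- As `W_n` is a Borel set, the measure `1_{W_n} μ` is the restriction `μ.restrict (K.W n)`. -/
theorem measurableSet_W (n : ℕ) : MeasurableSet (K.W n) :=
  ((G.isOpen_U n).measurableSet.diff (G.isOpen_U (n + 1)).measurableSet).diff
    K.measurableSet_ZUnion

theorem measurableSet_WInf : MeasurableSet K.WInf :=
  (MeasurableSet.iInter fun n => (G.isOpen_U n).measurableSet).diff K.measurableSet_ZUnion

/-- The dual operator `Q_n^*`: the measure `Q_n^*(μ)` given on Borel sets by
`Q_n^*(μ)(A) = ∫ Q_n(1_A) dμ`. -/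
def QStar (n : ℕ) (μ : Measure X) : Measure X :=
  Measure.ofMeasurable (fun A _ => ∫⁻ x, K.Q n (A.indicator 1) x ∂μ)
    (by
      have : K.Q n ((∅ : Set X).indicator 1) = 0 := by
        funext x
        unfold Q condExpOp classSum
        simp
      rw [this]
      simp)
    (by
      intro A hA hd
      have hsum : K.Q n ((⋃ i, A i).indicator 1) =
          fun x => ∑' i, K.Q n ((A i).indicator 1) x := by
        funext x
        rw [← K.Q_tsum]
        congr 1
        funext y
        by_cases hy : ∃ i, y ∈ A i
        · obtain ⟨i, hi⟩ := hy
          rw [tsum_eq_single i, indicator_of_mem hi, indicator_of_mem (mem_iUnion.2 ⟨i, hi⟩)]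
          exact fun j hj => indicator_of_notMem
            (fun hjy => Set.disjoint_left.1 (hd hj) hjy hi) _
        · have hy' : ∀ i, y ∉ A i := fun i hi => hy ⟨i, hi⟩
          simp [hy']
      simp only [hsum]
      exact lintegral_tsum
        (fun i => (K.measurable_Q n (measurable_one.indicator (hA i))).aemeasurable))

/-- The characterizing property of the dual operator. -/
theorem lintegral_QStar (n : ℕ) (μ : Measure X) {f : X → ℝ≥0∞} (hf : Measurable f) :
    ∫⁻ x, f x ∂(K.QStar n μ) = ∫⁻ x, K.Q n f x ∂μ := by
  refine Measurable.ennreal_induction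
    (motive := fun f => ∫⁻ x, f x ∂(K.QStar n μ) = ∫⁻ x, K.Q n f x ∂μ) ?_ ?_ ?_ hf
  · intro c A hA
    have h1 : K.Q n (A.indicator fun _ => c) = fun x => c * K.Q n (A.indicator 1) x := by
      funext x
      unfold Q
      split_ifs with hx
      · unfold condExpOp classSum
        rw [← ENNReal.tsum_mul_left]
        congr 1
        funext y
        by_cases hy : (y : X) ∈ A
        · simp [hy, mul_assoc]
        · simp [hy]
      · simp
    rw [h1, lintegral_const_mul _ (K.measurable_Q n (measurable_one.indicator hA)),
      lintegral_indicator_const hA, QStar, Measure.ofMeasurable_apply A hA]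
  · intro f g _ hf hg ihf ihg
    have h1 : K.Q n (f + g) = fun x => K.Q n f x + K.Q n g x := by
      funext x
      unfold Q
      split_ifs with hx
      · unfold condExpOp classSum
        rw [← ENNReal.tsum_add]
        simp only [Pi.add_apply, add_mul]
      · simp
    rw [h1, lintegral_add_left (K.measurable_Q n hf), ← ihf, ← ihg, ← lintegral_add_left hf]
    rfl
  · intro f hf hmono ih
    have hQmono : Monotone fun i => K.Q n (f i) := by
      intro i j hij x
      simp only [Q]
      split_ifs with hx
      · unfold condExpOp classSum
        refine ENNReal.tsum_le_tsum (fun y => ?_)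
        exact mul_le_mul_left (mul_le_mul_left (hmono hij _) _) _
      · exact le_rfl
    have h1 : K.Q n (fun x => ⨆ i, f i x) = fun x => ⨆ i, K.Q n (f i) x := by
      funext x
      unfold Q
      split_ifs with hx
      · unfold condExpOp
        simp only [ENNReal.iSup_mul]
        refine classSum_iSup _ _ (fun i j hij y => ?_) _
        exact mul_le_mul_left (mul_le_mul_left (hmono hij _) _) _
      · simp
    rw [h1, lintegral_iSup (fun i => K.measurable_Q n (hf i)) hQmono, lintegral_iSup hf hmono]
    exact iSup_congr ih

end Potential

end GAP

end

open ProperRel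

noncomputable section

namespace GAP

variable {X : Type*} [TopologicalSpace X] (G : GAP X)

/-! ### Bisections of the relations `R n` -/

/-! Both sides of the equivalence are compared with one local statement, `IsTransported`: every
partial homeomorphism `e` of `X` with graph in some `R n` (a bisection) carries `μ` on its source to
`D(e⁻¹(y), y) μ` on its target.

Quasi-invariance amounts to transport by all bisections. Graphs of bisections are open in `R` and
meet each fibre of the range and source maps at most once, so for a function supported on one graph
the defining identity is a change of variables along `e`. Finitely many graphs cover a compact
support (`isQuasiInvariant_of_isTransported`). Conversely, functions in `C_c(e.target)` extend by
zero to `C_c(R)` and determine the transported measure (`IsQuasiInvariant.isTransported`).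

Transport amounts to conditions (i)-(iii), see `isTransported_iff_conditions`. Summing transport
over a countable Borel partition of `U n` gives `∫_A ∑_{y ∈ R_n(x)} g(y) dμ(x) = ∫_A g ρ_n⁻¹ ζ_n dμ`
for `R n`-saturated Borel sets `A ⊆ U n` (`setLIntegral_orbitSum_eq`). The choice `g = 1_V` with `V`
small forces `μ(Z_n) = 0`, as the left side is finite; the choice `g = f ρ_n ζ_n⁻¹` gives invariance
under `QStar n`. Conversely, `Q n` takes equal values on `g ∘ e` and on density times `g`
(`Q_indicator_source_eq`), so a measure fixed by `QStar n` is transported by bisections of `R n`;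
the pieces of `μ` on the sets `W k` and `WInf` then add up to `μ`. -/

theorem mem_U_of_relOn {n m : ℕ} (hnm : n ≤ m) {x y : X} (h : G.relOn n x y) :
    x ∈ G.U m ↔ y ∈ G.U m :=
  ⟨fun hx => (G.relOn_of_le hnm (G.relOn_symm h) hx).1, fun hy => (G.relOn_of_le hnm h hy).1⟩

theorem U_antitone : Antitone G.U := antitone_nat_of_succ_le G.U_succ_subset

theorem relOn_refl {n : ℕ} {x : X} (hx : x ∈ G.U n) : G.relOn n x x := ⟨hx, hx, (G.R n).refl _⟩

theorem relOn_zero {x y : X} (h : G.relOn 0 x y) : x = y := by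
  obtain ⟨hx, hy, h⟩ := h
  exact congrArg Subtype.val ((G.R_zero _ _).1 h)

/-- An open partial homeomorphism of `X` whose graph is contained in `R n`. -/
def IsBisection (n : ℕ) (e : OpenPartialHomeomorph X X) : Prop :=
  ∀ x ∈ e.source, G.relOn n x (e x)

/-- The local inverse of the quotient map lives on the subtype `U n`. Composing with the inverse of
the open embedding `U n → X` moves it to `X`, so that bisections become partial homeomorphisms of
`X` itself. -/
theorem exists_chart {n : ℕ} {x : X} (hx : x ∈ G.U n) :
    ∃ P : OpenPartialHomeomorph X (Quotient (G.R n)), x ∈ P.source ∧ P.source ⊆ G.U n ∧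
      ∀ a ∈ P.source, ∀ h : a ∈ G.U n, P a = Quotient.mk (G.R n) ⟨a, h⟩ := by
  obtain ⟨p, hp, hpe⟩ := (G.isProper_R n).2 ⟨x, hx⟩
  have : Nonempty (G.U n) := ⟨⟨x, hx⟩⟩
  set c := (G.isOpen_U n).isOpenEmbedding_subtypeVal.toOpenPartialHomeomorph with hc
  have hcs : ∀ y : G.U n, c.symm y = y := fun y => c.left_inv (by simp [hc])
  have hct : c.target = G.U n := by simp [hc]
  refine ⟨c.symm.trans p, ?_, ?_, ?_⟩
  · rw [OpenPartialHomeomorph.trans_source]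
    refine ⟨by simpa [hct] using hx, ?_⟩
    rw [mem_preimage, hcs ⟨x, hx⟩]
    exact hp
  · intro a ha
    rw [OpenPartialHomeomorph.trans_source] at ha
    simpa [hct] using ha.1
  · intro a _ h
    rw [OpenPartialHomeomorph.coe_trans, Function.comp_apply, hcs ⟨a, h⟩, ← hpe]

theorem chart_eq_iff {n : ℕ} {P Q : OpenPartialHomeomorph X (Quotient (G.R n))}
    (hP : P.source ⊆ G.U n)
    (hP' : ∀ a ∈ P.source, ∀ h : a ∈ G.U n, P a = Quotient.mk (G.R n) ⟨a, h⟩)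
    (hQ : Q.source ⊆ G.U n)
    (hQ' : ∀ a ∈ Q.source, ∀ h : a ∈ G.U n, Q a = Quotient.mk (G.R n) ⟨a, h⟩)
    {x y : X} (hx : x ∈ P.source) (hy : y ∈ Q.source) : P x = Q y ↔ G.relOn n x y := by
  rw [hP' x hx (hP hx), hQ' y hy (hQ hy), Quotient.eq]
  exact ⟨fun h => ⟨_, _, h⟩, fun ⟨_, _, h⟩ => h⟩

/-- Chart domains work. Such a `V` meets each class at most once, which later bounds orbit sums and
shows that graphs are open. -/
theorem exists_relOn_injective_nhds {n : ℕ} {x : X} (hx : x ∈ G.U n) :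
    ∃ V : Set X, IsOpen V ∧ x ∈ V ∧ V ⊆ G.U n ∧ ∀ a ∈ V, ∀ b ∈ V, G.relOn n a b → a = b := by
  obtain ⟨P, hxP, hP, hP'⟩ := G.exists_chart hx
  exact ⟨P.source, P.open_source, hxP, hP, fun a ha b hb h =>
    P.injOn ha hb ((G.chart_eq_iff hP hP' hP hP' ha hb).2 h)⟩

theorem exists_isBisection {n : ℕ} {x y : X} (h : G.relOn n x y) :
    ∃ e : OpenPartialHomeomorph X X, G.IsBisection n e ∧ x ∈ e.source ∧ e x = y := by
  obtain ⟨P, hxP, hP, hP'⟩ := G.exists_chart h.1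
  obtain ⟨Q, hyQ, hQ, hQ'⟩ := G.exists_chart h.2.1
  have hPQ : P x = Q y := (G.chart_eq_iff hP hP' hQ hQ' hxP hyQ).2 h
  refine ⟨P.trans Q.symm, ?_, ?_, ?_⟩
  · intro z hz
    rw [OpenPartialHomeomorph.trans_source] at hz
    have hz2 : P z ∈ Q.target := hz.2
    refine (G.chart_eq_iff hP hP' hQ hQ' hz.1 (Q.map_target hz2)).1 (Q.right_inv hz2).symm
  · rw [OpenPartialHomeomorph.trans_source]
    refine ⟨hxP, ?_⟩
    change P x ∈ Q.target
    rw [hPQ]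
    exact Q.map_source hyQ
  · change Q.symm (P x) = y
    rw [hPQ, Q.left_inv hyQ]

/-- A countable Borel partition of `U n` such that the equivalences between any two of its pieces
are implemented by a bisection of `R n`. -/
structure BisectionPartition [MeasurableSpace X] (n : ℕ) where
  B : ℕ → Set X
  e : ℕ → ℕ → OpenPartialHomeomorph X X
  measurableSet_B : ∀ i, MeasurableSet (B i)
  disjoint_B : Pairwise (Function.onFun Disjoint B)
  iUnion_B : ⋃ i, B i = G.U n
  isBisection_e : ∀ i j, G.IsBisection n (e i j)
  symm_e : ∀ i j, (e i j).symm = e j i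
  rel_e : ∀ i j, ∀ x ∈ B i, ∀ y ∈ B j, G.relOn n x y → x ∈ (e i j).source ∧ e i j x = y

/-- By second countability, countably many chart domains cover `U n`; the pieces are these domains
made disjoint, and `e i j` is the `i`-th chart followed by the inverse of the `j`-th. -/
theorem nonempty_bisectionPartition [SecondCountableTopology X] [MeasurableSpace X] [BorelSpace X]
    (n : ℕ) : Nonempty (G.BisectionPartition n) := by
  -- Enumerating the charts by `ℕ` requires at least one of them.
  rcases (G.U n).eq_empty_or_nonempty with hU | ⟨x₀, hx₀⟩
  · refine ⟨⟨fun _ => ∅, fun _ _ => OpenPartialHomeomorph.ofSet ∅ isOpen_empty, by simp,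
      fun i j _ => by simp [Function.onFun], by simp [hU], fun i j x hx => ?_, fun i j => by simp,
      fun i j x hx => ?_⟩⟩
    · simp at hx
    · simp at hx
  choose P hxP hP hP' using fun x : G.U n => G.exists_chart x.2
  obtain ⟨S, hSc, hS⟩ := TopologicalSpace.countable_cover_nhds
    (f := fun x : G.U n => Subtype.val ⁻¹' (P x).source)
    (fun x => ((P x).open_source.preimage continuous_subtype_val).mem_nhds (hxP x))
  have hSne : S.Nonempty := by
    by_contra h
    rw [not_nonempty_iff_eq_empty.1 h] at hS
    have : (⟨x₀, hx₀⟩ : G.U n) ∈ (univ : Set (G.U n)) := mem_univ _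
    rw [← hS] at this
    simp at this
  obtain ⟨u, hu⟩ := hSc.exists_eq_range hSne
  have hcov : ∀ x : G.U n, ∃ i, (x : X) ∈ (P (u i)).source := by
    intro x
    have : x ∈ (univ : Set (G.U n)) := mem_univ _
    rw [← hS, hu] at this
    simpa using this
  set W : ℕ → Set X := fun i => (P (u i)).source with hW
  have hsub : ∀ i, disjointed W i ⊆ W i := fun i => disjointed_subset W i
  refine ⟨⟨disjointed W, fun i j => (P (u i)).trans (P (u j)).symm,
    MeasurableSet.disjointed (fun i => (P (u i)).open_source.measurableSet),
    disjoint_disjointed W, ?_, ?_, ?_, ?_⟩⟩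
  · rw [iUnion_disjointed]
    refine Subset.antisymm (iUnion_subset fun i => hP (u i)) fun x hx => ?_
    exact mem_iUnion.2 (hcov ⟨x, hx⟩)
  · intro i j z hz
    rw [OpenPartialHomeomorph.trans_source] at hz
    have hz2 : P (u i) z ∈ (P (u j)).target := hz.2
    refine (G.chart_eq_iff (hP _) (hP' _) (hP _) (hP' _) hz.1 ((P (u j)).map_target hz2)).1
      ((P (u j)).right_inv hz2).symm
  · intro i j
    rw [OpenPartialHomeomorph.trans_symm_eq_symm_trans_symm, OpenPartialHomeomorph.symm_symm]
  · intro i j x hx y hy h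
    have hx' := hsub i hx
    have hy' := hsub j hy
    have hPQ := (G.chart_eq_iff (hP _) (hP' _) (hP _) (hP' _) hx' hy').2 h
    refine ⟨?_, ?_⟩
    · rw [OpenPartialHomeomorph.trans_source]
      refine ⟨hx', ?_⟩
      change P (u i) x ∈ (P (u j)).target
      rw [hPQ]
      exact (P (u j)).map_source hy'
    · change (P (u j)).symm (P (u i) x) = y
      rw [hPQ, (P (u j)).left_inv hy']

/-! ### Sums over the orbits of `R n` -/

/-- The sum of a function over the `R n`-class of a point of `X`; it vanishes off `U n`. -/
def orbitSum (n : ℕ) (F : X → ℝ≥0∞) (x : X) : ℝ≥0∞ := ∑' y : {y : X // G.relOn n x y}, F y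

theorem orbitSum_eq_indicator (n : ℕ) (F : X → ℝ≥0∞) (x : X) :
    G.orbitSum n F x = ∑' y, {y | G.relOn n x y}.indicator F y :=
  tsum_subtype {y | G.relOn n x y} F

theorem orbitSum_of_notMem {n : ℕ} (F : X → ℝ≥0∞) {x : X} (hx : x ∉ G.U n) :
    G.orbitSum n F x = 0 := by
  have : IsEmpty {y : X // G.relOn n x y} := ⟨fun y => hx y.2.1⟩
  exact tsum_empty

theorem classSum_eq_orbitSum (n : ℕ) (F : X → ℝ≥0∞) (x : G.U n) :
    classSum (G.R n) (fun y => F y) x = G.orbitSum n F x := by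
  let φ : {y : G.U n // G.R n x y} ≃ {y : X // G.relOn n x y} :=
    { toFun := fun y => ⟨y.1, x.2, y.1.2, y.2⟩
      invFun := fun y => ⟨⟨y.1, y.2.2.1⟩, y.2.2.2⟩
      left_inv := fun y => rfl
      right_inv := fun y => rfl }
  exact φ.tsum_eq (fun y : {y : X // G.relOn n x y} => F y)

theorem orbitSum_eq_of_relOn {n : ℕ} (F : X → ℝ≥0∞) {x y : X} (h : G.relOn n x y) :
    G.orbitSum n F x = G.orbitSum n F y := by
  have : {z | G.relOn n x z} = {z | G.relOn n y z} := by
    ext z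
    exact ⟨G.relOn_trans (G.relOn_symm h), G.relOn_trans h⟩
  rw [orbitSum_eq_indicator, orbitSum_eq_indicator, this]

theorem le_orbitSum {n : ℕ} (F : X → ℝ≥0∞) {x : X} (hx : x ∈ G.U n) : F x ≤ G.orbitSum n F x :=
  ENNReal.le_tsum (f := fun y : {y : X // G.relOn n x y} => F y) ⟨x, G.relOn_refl hx⟩

theorem measurable_orbitSum [SecondCountableTopology X] [MeasurableSpace X] [BorelSpace X]
    (n : ℕ) {F : X → ℝ≥0∞} (hF : Measurable F) : Measurable (G.orbitSum n F) := by
  refine measurable_of_restrict_of_restrict_compl (G.isOpen_U n).measurableSet ?_ ?_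
  · have : (G.U n).domRestrict (G.orbitSum n F) = classSum (G.R n) (fun y => F y) := by
      funext x
      exact (G.classSum_eq_orbitSum n F x).symm
    rw [this]
    exact measurable_classSum (G.isProper_R n) (hF.comp measurable_subtype_coe)
  · have : (G.U n)ᶜ.domRestrict (G.orbitSum n F) = fun _ => 0 := by
      funext x
      exact G.orbitSum_of_notMem F x.2
    rw [this]
    exact measurable_const

/-- Each piece `B j` meets the class of `x ∈ B i` in at most one point, and that point can only be
`e i j x`. -/
theorem BisectionPartition.orbitSum_eq [MeasurableSpace X] {G : GAP X} {n : ℕ}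
    (p : G.BisectionPartition n)
    (F : X → ℝ≥0∞) {i : ℕ} {x : X} (hx : x ∈ p.B i) :
    G.orbitSum n F x = ∑' j, (p.e i j).source.indicator
      (fun x => (p.B j).indicator F (p.e i j x)) x := by
  have hxU : x ∈ G.U n := p.iUnion_B ▸ mem_iUnion.2 ⟨i, hx⟩
  have hsplit : ∀ y, {y | G.relOn n x y}.indicator F y =
      ∑' j, {y | G.relOn n x y}.indicator ((p.B j).indicator F) y := by
    intro y
    by_cases hy : G.relOn n x y
    · have hyU : y ∈ ⋃ j, p.B j := p.iUnion_B ▸ hy.2.1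
      obtain ⟨j, hj⟩ := mem_iUnion.1 hyU
      have hy' : y ∈ {y | G.relOn n x y} := hy
      simp only [indicator_of_mem hy']
      rw [tsum_eq_single j, indicator_of_mem hj]
      intro k hk
      exact indicator_of_notMem (fun h => Set.disjoint_left.1 (p.disjoint_B hk) h hj) _
    · have hy' : y ∉ {y | G.relOn n x y} := hy
      simp [indicator_of_notMem hy']
  rw [orbitSum_eq_indicator]
  simp_rw [hsplit]
  rw [ENNReal.tsum_comm]
  refine tsum_congr fun j => ?_
  by_cases hs : x ∈ (p.e i j).source
  · rw [indicator_of_mem hs, tsum_eq_single (p.e i j x)]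
    · rw [indicator_of_mem (show p.e i j x ∈ {y | G.relOn n x y} from p.isBisection_e i j x hs)]
    · intro y hy
      by_cases hr : G.relOn n x y
      · rw [indicator_of_mem (show y ∈ {y | G.relOn n x y} from hr)]
        exact indicator_of_notMem (fun hyj => hy (p.rel_e i j x hx y hyj hr).2.symm) _
      · exact indicator_of_notMem (show y ∉ {y | G.relOn n x y} from hr) _
  · rw [indicator_of_notMem hs]
    refine ENNReal.tsum_eq_zero.2 fun y => ?_
    by_cases hr : G.relOn n x y
    · rw [indicator_of_mem (show y ∈ {y | G.relOn n x y} from hr)]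
      exact indicator_of_notMem (fun hyj => hs (p.rel_e i j x hx y hyj hr).1) _
    · exact indicator_of_notMem (show y ∉ {y | G.relOn n x y} from hr) _

namespace Potential

variable {G}
variable (K : G.Potential)

/-! ### The density and the partition function as functions on `X` -/

open Classical in
/-- `h_n`, extended by `0` to all of `X`. -/
def hExt (n : ℕ) (x : X) : ℝ := if hx : x ∈ G.U n then K.h n ⟨x, hx⟩ else 0

theorem hExt_of_mem {n : ℕ} {x : X} (hx : x ∈ G.U n) : K.hExt n x = K.h n ⟨x, hx⟩ := dif_pos hx

/-- `ρ_n`, extended to all of `X`. -/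
def rhoExt (n : ℕ) (x : X) : ℝ≥0∞ := ENNReal.ofReal (Real.exp (K.hExt n x))

/-- `ζ_n`, extended by `0` to all of `X`. -/
def zetaExt (n : ℕ) : X → ℝ≥0∞ := G.orbitSum n (K.rhoExt n)

theorem rhoExt_ne_zero (n : ℕ) (x : X) : K.rhoExt n x ≠ 0 := by
  simp [rhoExt, Real.exp_pos]

theorem rhoExt_ne_top (n : ℕ) (x : X) : K.rhoExt n x ≠ ∞ := ENNReal.ofReal_ne_top

theorem rho_eq_rhoExt (n : ℕ) : K.rho n = fun x : G.U n => K.rhoExt n x := by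
  funext x
  rw [rho, rhoExt, K.hExt_of_mem x.2]

theorem zeta_eq_zetaExt (n : ℕ) (x : G.U n) : K.zeta n x = K.zetaExt n x := by
  rw [zeta, partitionFn, rho_eq_rhoExt, zetaExt, classSum_eq_orbitSum]

theorem Z_eq (n : ℕ) : K.Z n = {x | K.zetaExt n x = ∞} := by
  ext x
  constructor
  · rintro ⟨hx, h⟩
    rwa [zeta_eq_zetaExt] at h
  · intro h
    have hx : x ∈ G.U n := by
      by_contra hx
      rw [mem_ofPred_eq, zetaExt, G.orbitSum_of_notMem _ hx] at h
      simp at h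
    refine ⟨hx, ?_⟩
    rwa [zeta_eq_zetaExt]

theorem Q_eq_orbitSum (n : ℕ) (f : X → ℝ≥0∞) (x : X) :
    K.Q n f x = G.orbitSum n (fun y => f y * K.rhoExt n y * (K.zetaExt n y)⁻¹) x := by
  unfold Q
  split_ifs with hx
  · rw [← G.classSum_eq_orbitSum n _ ⟨x, hx⟩]
    unfold condExpOp
    congr 1
    funext y
    rw [rho_eq_rhoExt, ← zeta_eq_zetaExt, zeta, rho_eq_rhoExt]
  · rw [G.orbitSum_of_notMem _ hx]

theorem zetaExt_ne_zero {n : ℕ} {x : X} (hx : x ∈ G.U n) : K.zetaExt n x ≠ 0 :=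
  fun h => K.rhoExt_ne_zero n x (le_antisymm (h ▸ G.le_orbitSum (K.rhoExt n) hx) bot_le)

theorem zetaExt_eq_of_relOn {n : ℕ} {x y : X} (h : G.relOn n x y) :
    K.zetaExt n x = K.zetaExt n y :=
  G.orbitSum_eq_of_relOn _ h

theorem hExt_sub_hExt_eq {n m : ℕ} {x y : X} (hn : G.relOn n x y)
    (hm : G.relOn m x y) : K.hExt n x - K.hExt n y = K.hExt m x - K.hExt m y := by
  rw [K.hExt_of_mem hn.1, K.hExt_of_mem hn.2.1, K.hExt_of_mem hm.1, K.hExt_of_mem hm.2.1]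
  rcases le_total n m with hnm | hnm
  · exact K.h_sub_h_eq hnm hn hm
  · exact (K.h_sub_h_eq hnm hm hn).symm

theorem D_eq {n : ℕ} (γ : G.Groupoid) (h : G.relOn n γ.range γ.source) :
    K.D γ = Real.exp (K.hExt n γ.range - K.hExt n γ.source) := by
  rw [D, K.cocycle_eq γ n h, K.hExt_of_mem h.1, K.hExt_of_mem h.2.1]

/-- The `R n`-class of `x` lies in its `R m`-class, and `h_m - h_n` is constant on the former; hence
`ρ_m` is there a positive multiple `c` of `ρ_n`. -/
theorem zetaExt_eq_top_of_le {n m : ℕ} (hnm : n ≤ m) {x : X} (hx : x ∈ G.U m)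
    (h : K.zetaExt n x = ∞) : K.zetaExt m x = ∞ := by
  have hxn : x ∈ G.U n := G.U_antitone hnm hx
  set c : ℝ≥0∞ := ENNReal.ofReal (Real.exp (K.hExt m x - K.hExt n x)) with hc
  have hle : c * K.zetaExt n x ≤ K.zetaExt m x := by
    rw [zetaExt, zetaExt, orbitSum_eq_indicator, orbitSum_eq_indicator, ← ENNReal.tsum_mul_left]
    refine ENNReal.tsum_le_tsum fun y => ?_
    by_cases hy : G.relOn n x y
    · have hym : G.relOn m x y := G.relOn_of_le hnm hy ((G.mem_U_of_relOn hnm hy).1 hx)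
      rw [indicator_of_mem (show y ∈ {y | G.relOn n x y} from hy),
        indicator_of_mem (show y ∈ {y | G.relOn m x y} from hym), hc, rhoExt, rhoExt,
        ← ENNReal.ofReal_mul (Real.exp_pos _).le, ← Real.exp_add]
      have := K.hExt_sub_hExt_eq hy hym
      exact (congrArg (fun t => ENNReal.ofReal (Real.exp t)) (by linarith)).le
    · rw [indicator_of_notMem (show y ∉ {y | G.relOn n x y} from hy), mul_zero]
      exact bot_le
  have hc0 : c ≠ 0 := by simp [hc, Real.exp_pos]
  rw [h, ENNReal.mul_top hc0] at hle
  exact top_le_iff.1 hle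

theorem mem_ZUnion {x : X} : x ∈ K.ZUnion ↔ ∃ n, K.zetaExt n x = ∞ := by
  simp [ZUnion, Z_eq]

/-- If `ζ_n(x) = ∞` and `n ≤ m`, the infinite value passes up to level `m`, where it is constant on
classes; if `m ≤ n`, the relation passes up to level `n` instead. -/
theorem mem_ZUnion_of_relOn {m : ℕ} {x y : X} (h : G.relOn m x y) (hx : x ∈ K.ZUnion) :
    y ∈ K.ZUnion := by
  obtain ⟨n, hn⟩ := K.mem_ZUnion.1 hx
  have hxn : x ∈ G.U n := by
    by_contra hxn
    rw [zetaExt, G.orbitSum_of_notMem _ hxn] at hn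
    simp at hn
  rw [mem_ZUnion]
  rcases le_total n m with hnm | hnm
  · refine ⟨m, ?_⟩
    rw [← K.zetaExt_eq_of_relOn h]
    exact K.zetaExt_eq_top_of_le hnm h.1 hn
  · refine ⟨n, ?_⟩
    rw [← K.zetaExt_eq_of_relOn (G.relOn_of_le hnm h ((G.mem_U_of_relOn hnm h).1 hxn))]
    exact hn

theorem mem_W_of_relOn {k : ℕ} {x y : X} (h : G.relOn k x y) (hx : x ∈ K.W k) : y ∈ K.W k :=
  ⟨⟨h.2.1, fun hy => hx.1.2 ((G.mem_U_of_relOn k.le_succ h).2 hy)⟩,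
    fun hy => hx.2 (K.mem_ZUnion_of_relOn (G.relOn_symm h) hy)⟩

theorem mem_WInf_of_relOn {i : ℕ} {x y : X} (h : G.relOn i x y) (hx : x ∈ K.WInf) :
    y ∈ K.WInf := by
  refine ⟨mem_iInter.2 fun m => ?_,
    fun hy => hx.2 (K.mem_ZUnion_of_relOn (G.relOn_symm h) hy)⟩
  have hxm := mem_iInter.1 hx.1
  rcases le_total i m with him | him
  · exact (G.mem_U_of_relOn him h).1 (hxm m)
  · exact G.U_antitone him h.2.1

/-- Classes of `R 0` are singletons, so `ζ_0 = ρ_0`. This supplies the index `0`, which conditions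
(ii) and (iii) leave out. -/
theorem Q_zero (f : X → ℝ≥0∞) : K.Q 0 f = f := by
  have h0 : ∀ (F : X → ℝ≥0∞) (x : X), G.orbitSum 0 F x = F x := by
    intro F x
    have hx : x ∈ G.U 0 := G.U_zero ▸ mem_univ x
    unfold orbitSum
    rw [tsum_eq_single (⟨x, G.relOn_refl hx⟩ : {y : X // G.relOn 0 x y})]
    exact fun y hy => absurd (Subtype.ext (G.relOn_zero y.2).symm) hy
  funext x
  rw [Q_eq_orbitSum, h0, zetaExt, h0, mul_assoc,
    ENNReal.mul_inv_cancel (K.rhoExt_ne_zero 0 x) (K.rhoExt_ne_top 0 x), mul_one]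

variable [MeasurableSpace X] [BorelSpace X]

theorem measurable_hExt (n : ℕ) : Measurable (K.hExt n) := by
  classical
  exact Measurable.dite (s := G.U n) (K.continuous_h n).measurable measurable_const
    (G.isOpen_U n).measurableSet

theorem measurable_rhoExt (n : ℕ) : Measurable (K.rhoExt n) :=
  (Real.measurable_exp.comp (K.measurable_hExt n)).ennreal_ofReal

theorem measurable_zetaExt [SecondCountableTopology X] (n : ℕ) : Measurable (K.zetaExt n) :=
  G.measurable_orbitSum n (K.measurable_rhoExt n)

end Potential

end GAP

/-! ### Measurability of open partial homeomorphisms -/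

namespace OpenPartialHomeomorph

variable {X : Type*} [TopologicalSpace X] [MeasurableSpace X] [BorelSpace X]

/-- The values of `e` off its source are arbitrary and need not be measurable; they are replaced by
those of the identity. -/
theorem exists_measurable_eqOn_source (e : OpenPartialHomeomorph X X) :
    ∃ f : X → X, Measurable f ∧ EqOn f e e.source := by
  classical
  exact ⟨e.source.piecewise e id,
    e.continuousOn.measurable_piecewise continuousOn_id e.open_source.measurableSet,
    piecewise_eqOn _ _ _⟩

theorem aemeasurable_restrict_source (e : OpenPartialHomeomorph X X) (μ : Measure X) :
    AEMeasurable e (μ.restrict e.source) := by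
  obtain ⟨f, hf, hfe⟩ := e.exists_measurable_eqOn_source
  refine ⟨f, hf, ?_⟩
  filter_upwards [ae_restrict_mem e.open_source.measurableSet] with x hx
  exact (hfe hx).symm

end OpenPartialHomeomorph

namespace GAP

variable {X : Type*} [TopologicalSpace X] {G : GAP X}

/-! ### Measures transported by bisections -/

namespace Potential

variable (K : G.Potential)

/-- The Radon-Nikodym density `y ↦ D(e⁻¹(y), y)` attached to a bisection `e` of `R n`. -/
def density (n : ℕ) (e : OpenPartialHomeomorph X X) (y : X) : ℝ≥0∞ :=
  ENNReal.ofReal (Real.exp (K.hExt n (e.symm y) - K.hExt n y))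

theorem density_mul_rhoExt (n : ℕ) (e : OpenPartialHomeomorph X X) (y : X) :
    K.density n e y * K.rhoExt n y = K.rhoExt n (e.symm y) := by
  rw [density, rhoExt, rhoExt, ← ENNReal.ofReal_mul (Real.exp_pos _).le, ← Real.exp_add]
  congr 2
  ring

theorem density_eq (n : ℕ) (e : OpenPartialHomeomorph X X) (y : X) :
    K.density n e y = K.rhoExt n (e.symm y) * (K.rhoExt n y)⁻¹ := by
  rw [← density_mul_rhoExt, mul_assoc,
    ENNReal.mul_inv_cancel (K.rhoExt_ne_zero n y) (K.rhoExt_ne_top n y), mul_one]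

/-- `e` maps the part of a class in its source bijectively onto the part in its target, `ζ_n` is
constant on the class, and the density is the ratio of the values of `ρ_n`. The sums therefore agree
term by term, even where `ζ_n = ∞`. -/
theorem Q_indicator_source_eq {n : ℕ} {e : OpenPartialHomeomorph X X} (he : G.IsBisection n e)
    (g : X → ℝ≥0∞) (z : X) :
    K.Q n (e.source.indicator fun x => g (e x)) z =
      K.Q n (e.target.indicator fun y => K.density n e y * g y) z := by
  rw [Q_eq_orbitSum, Q_eq_orbitSum, orbitSum_eq_indicator, orbitSum_eq_indicator]
  set O := {y | G.relOn n z y} with hO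
  have h1 : ∀ y, O.indicator (fun y => e.source.indicator (fun x => g (e x)) y *
      K.rhoExt n y * (K.zetaExt n y)⁻¹) y =
      (O ∩ e.source).indicator (fun y => g (e y) * K.rhoExt n y * (K.zetaExt n y)⁻¹) y := by
    intro y
    rw [← indicator_indicator]
    by_cases hy : y ∈ O <;> by_cases hys : y ∈ e.source <;> simp [hy, hys]
  have h2 : ∀ y, O.indicator (fun y => e.target.indicator (fun y => K.density n e y * g y) y *
      K.rhoExt n y * (K.zetaExt n y)⁻¹) y =
      (O ∩ e.target).indicator
        (fun y => K.density n e y * g y * K.rhoExt n y * (K.zetaExt n y)⁻¹) y := by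
    intro y
    rw [← indicator_indicator]
    by_cases hy : y ∈ O <;> by_cases hys : y ∈ e.target <;> simp [hy, hys]
  simp_rw [h1, h2, ← tsum_subtype]
  let φ : ↥(O ∩ e.source) ≃ ↥(O ∩ e.target) :=
    { toFun := fun x => ⟨e x, G.relOn_trans x.2.1 (he x x.2.2), e.map_source x.2.2⟩
      invFun := fun y => ⟨e.symm y, G.relOn_trans y.2.1 (G.relOn_symm (by
        simpa only [e.right_inv y.2.2] using he _ (e.map_target y.2.2))), e.map_target y.2.2⟩
      left_inv := fun x => Subtype.ext (e.left_inv x.2.2)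
      right_inv := fun y => Subtype.ext (e.right_inv y.2.2) }
  rw [← φ.tsum_eq]
  refine tsum_congr fun x => ?_
  change _ = K.density n e (e x) * g (e x) * K.rhoExt n (e x) * (K.zetaExt n (e x))⁻¹
  rw [mul_right_comm (K.density n e (e x)), density_mul_rhoExt, e.left_inv x.2.2,
    ← K.zetaExt_eq_of_relOn (he x x.2.2), mul_comm (K.rhoExt n _)]

variable [MeasurableSpace X] [BorelSpace X]

/-- A bisection `e` of `R n` carries `μ` to the measure with density `D(e⁻¹(y), y)`. -/
def IsTransported (n : ℕ) (e : OpenPartialHomeomorph X X) (μ : Measure X) : Prop :=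
  Measure.map e (μ.restrict e.source) = (μ.restrict e.target).withDensity (K.density n e)

theorem aemeasurable_density (n : ℕ) (e : OpenPartialHomeomorph X X) (μ : Measure X) :
    AEMeasurable (K.density n e) (μ.restrict e.target) := by
  refine (Real.measurable_exp.comp_aemeasurable (AEMeasurable.sub ?_ ?_)).ennreal_ofReal
  · exact (K.measurable_hExt n).comp_aemeasurable (e.symm.aemeasurable_restrict_source μ)
  · exact (K.measurable_hExt n).aemeasurable

variable {K}

theorem IsTransported.lintegral_eq {n : ℕ} {e : OpenPartialHomeomorph X X} {μ : Measure X}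
    (h : K.IsTransported n e μ) {g : X → ℝ≥0∞} (hg : AEMeasurable g (μ.restrict e.target)) :
    ∫⁻ x in e.source, g (e x) ∂μ = ∫⁻ y in e.target, K.density n e y * g y ∂μ := by
  have hac : AEMeasurable g ((μ.restrict e.target).withDensity (K.density n e)) :=
    hg.mono_ac (withDensity_absolutelyContinuous _ _)
  have h' := h
  unfold IsTransported at h'
  rw [← lintegral_map' (by rwa [h']) (e.aemeasurable_restrict_source μ), h',
    lintegral_withDensity_eq_lintegral_mul₀' (K.aemeasurable_density n e μ) hac]
  rfl

theorem isTransported_of_lintegral_eq {n : ℕ} {e : OpenPartialHomeomorph X X} {μ : Measure X}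
    (h : ∀ g : X → ℝ≥0∞, Measurable g →
      ∫⁻ x in e.source, g (e x) ∂μ = ∫⁻ y in e.target, K.density n e y * g y ∂μ) :
    K.IsTransported n e μ := by
  refine Measure.ext_of_lintegral _ fun g hg => ?_
  rw [lintegral_map' hg.aemeasurable (e.aemeasurable_restrict_source μ), h g hg,
    lintegral_withDensity_eq_lintegral_mul₀' (K.aemeasurable_density n e μ) hg.aemeasurable]
  rfl

variable (K)

/-! ### From invariance under `Q n` to transport by bisections -/

theorem measurable_indicator_density_mul (n : ℕ) (e : OpenPartialHomeomorph X X)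
    {g : X → ℝ≥0∞} (hg : Measurable g) :
    Measurable (e.target.indicator fun y => K.density n e y * g y) := by
  obtain ⟨f, hf, hfe⟩ := e.symm.exists_measurable_eqOn_source
  have : (e.target.indicator fun y => K.density n e y * g y) = e.target.indicator
      fun y => ENNReal.ofReal (Real.exp (K.hExt n (f y) - K.hExt n y)) * g y := by
    refine indicator_congr fun y hy => ?_
    rw [hfe hy, density]
  rw [this]
  refine Measurable.indicator (Measurable.mul ?_ hg) e.open_target.measurableSet
  exact (Real.measurable_exp.comp (((K.measurable_hExt n).comp hf).sub
    (K.measurable_hExt n))).ennreal_ofReal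

theorem measurable_indicator_source_comp (e : OpenPartialHomeomorph X X)
    {g : X → ℝ≥0∞} (hg : Measurable g) :
    Measurable (e.source.indicator fun x => g (e x)) := by
  obtain ⟨f, hf, hfe⟩ := e.exists_measurable_eqOn_source
  have : (e.source.indicator fun x => g (e x)) = e.source.indicator fun x => g (f x) :=
    indicator_congr fun x hx => by rw [hfe hx]
  rw [this]
  exact (hg.comp hf).indicator e.open_source.measurableSet

theorem isTransported_sum {ι : Type*} [Countable ι] {n : ℕ} {e : OpenPartialHomeomorph X X}
    {μ : ι → Measure X} (h : ∀ i, K.IsTransported n e (μ i)) :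
    K.IsTransported n e (Measure.sum μ) := by
  refine isTransported_of_lintegral_eq fun g hg => ?_
  rw [Measure.restrict_sum _ e.open_source.measurableSet,
    Measure.restrict_sum _ e.open_target.measurableSet, lintegral_sum_measure,
    lintegral_sum_measure]
  exact tsum_congr fun i => (h i).lintegral_eq hg.aemeasurable

variable [SecondCountableTopology X]

theorem isTransported_of_QStar_eq {n : ℕ} {e : OpenPartialHomeomorph X X}
    (he : G.IsBisection n e) {ν : Measure X} (hν : K.QStar n ν = ν) : K.IsTransported n e ν := by
  refine isTransported_of_lintegral_eq fun g hg => ?_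
  rw [← lintegral_indicator e.open_source.measurableSet,
    ← lintegral_indicator e.open_target.measurableSet, ← hν,
    K.lintegral_QStar n ν (measurable_indicator_source_comp e hg),
    K.lintegral_QStar n ν (K.measurable_indicator_density_mul n e hg)]
  exact lintegral_congr fun z => K.Q_indicator_source_eq he g z

theorem QStar_zero (ν : Measure X) : K.QStar 0 ν = ν := by
  refine Measure.ext_of_lintegral _ fun f hf => ?_
  rw [K.lintegral_QStar 0 ν hf, Q_zero]

/-- Invariance at level `k` alone handles bisections of every level `n`, since `W k` lies in `U k`
and misses `U (k + 1)`. -/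
theorem isTransported_restrict_W {n k : ℕ} {e : OpenPartialHomeomorph X X}
    (he : G.IsBisection n e) {μ : Measure X}
    (h : K.QStar k (μ.restrict (K.W k)) = μ.restrict (K.W k)) :
    K.IsTransported n e (μ.restrict (K.W k)) := by
  refine isTransported_of_lintegral_eq fun g hg => ?_
  rw [← lintegral_indicator e.open_source.measurableSet,
    ← lintegral_indicator e.open_target.measurableSet]
  rcases lt_or_ge k n with hkn | hnk
  -- For `n > k` the source and target of `e` lie in `U n`, which misses `W k`: both integrals
  -- vanish.
  · have hU : ∀ x ∈ K.W k, x ∉ G.U n := fun x hx hxn => hx.1.2 (G.U_antitone hkn hxn)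
    have hs : ∀ x ∈ K.W k, x ∉ e.source := fun x hx hxs => hU x hx (he x hxs).1
    have ht : ∀ x ∈ K.W k, x ∉ e.target := fun x hx hxt => hU x hx (by
      simpa only [e.right_inv hxt] using (he _ (e.map_target hxt)).2.1)
    rw [setLIntegral_congr_fun (K.measurableSet_W k) fun x hx => indicator_of_notMem (hs x hx) _,
      setLIntegral_congr_fun (K.measurableSet_W k) fun x hx => indicator_of_notMem (ht x hx) _]
  -- For `n ≤ k` the restriction of `e` to `U k` is a bisection of `R k`; as `U k` is saturated
  -- under `R n`, nothing of `W k` is lost from the source or the target.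
  · set e' := e.restrOpen (G.U k) (G.isOpen_U k) with he'_def
    have hsrc : e'.source = e.source ∩ G.U k := rfl
    have hsymm : ∀ y, e'.symm y = e.symm y := fun y => rfl
    have he' : G.IsBisection k e' := by
      intro x hx
      rw [hsrc] at hx
      have := he x hx.1
      exact G.relOn_of_le hnk this ((G.mem_U_of_relOn hnk this).1 hx.2)
    have htgt : ∀ y ∈ G.U k, y ∈ e'.target ↔ y ∈ e.target := by
      intro y hy
      refine ⟨fun h => h.1, fun h => ?_⟩
      have hr : G.relOn n (e.symm y) y := by
        simpa only [e.right_inv h] using he _ (e.map_target h)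
      have : e.symm y ∈ e'.source := ⟨e.map_target h, (G.mem_U_of_relOn hnk hr).2 hy⟩
      have h2 := e'.map_source this
      change e (e.symm y) ∈ e'.target at h2
      rwa [e.right_inv h] at h2
    have key := (K.isTransported_of_QStar_eq he' h).lintegral_eq hg.aemeasurable
    rw [← lintegral_indicator e'.open_source.measurableSet,
      ← lintegral_indicator e'.open_target.measurableSet] at key
    refine Eq.trans ?_ (key.trans ?_)
    · refine setLIntegral_congr_fun (K.measurableSet_W k) fun x hx => ?_
      by_cases hxs : x ∈ e.source
      · rw [indicator_of_mem hxs, indicator_of_mem (show x ∈ e'.source from ⟨hxs, hx.1.1⟩)]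
        rfl
      · rw [indicator_of_notMem hxs, indicator_of_notMem fun h : x ∈ e'.source => hxs h.1]
    · refine setLIntegral_congr_fun (K.measurableSet_W k) fun y hy => ?_
      by_cases hyt : y ∈ e.target
      · have hyt' := (htgt y hy.1.1).2 hyt
        rw [indicator_of_mem hyt, indicator_of_mem hyt']
        have hr : G.relOn n (e.symm y) y := by
          simpa only [e.right_inv hyt] using he _ (e.map_target hyt)
        have hr' : G.relOn k (e.symm y) y := G.relOn_of_le hnk hr hy.1.1
        -- The densities at levels `n` and `k` agree because the cocycle does not depend on the
        -- level.
        rw [density, density, hsymm, K.hExt_sub_hExt_eq hr hr']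
      · rw [indicator_of_notMem hyt, indicator_of_notMem fun h => hyt ((htgt y hy.1.1).1 h)]

theorem isTransported_of_conditions {μ : Measure X} (hZ : μ K.ZUnion = 0)
    (hW : ∀ k : ℕ, 1 ≤ k → K.QStar k (μ.restrict (K.W k)) = μ.restrict (K.W k))
    (hI : ∀ i : ℕ, 1 ≤ i → K.QStar i (μ.restrict K.WInf) = μ.restrict K.WInf)
    {n : ℕ} {e : OpenPartialHomeomorph X X} (he : G.IsBisection n e) :
    K.IsTransported n e μ := by
  -- `none` stands for `∞`; the sets `V o` partition the complement of `Z`, because a point either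
  -- stays in all `U m` or leaves the decreasing sequence exactly once.
  let V : Option ℕ → Set X := fun o => o.elim K.WInf K.W
  have hVm : ∀ o, MeasurableSet (V o) := by
    rintro (_ | k)
    exacts [K.measurableSet_WInf, K.measurableSet_W k]
  have hWI : ∀ k, Disjoint (K.W k) K.WInf := fun k => Set.disjoint_left.2 fun x hx hx' =>
    hx.1.2 (mem_iInter.1 hx'.1 (k + 1))
  have hWW : ∀ j k, j < k → Disjoint (K.W j) (K.W k) := fun j k hjk =>
    Set.disjoint_left.2 fun x hx hx' => hx.1.2 (G.U_antitone hjk hx'.1.1)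
  have hVd : Pairwise (Function.onFun Disjoint V) := by
    rintro (_ | j) (_ | k) hne
    · exact absurd rfl hne
    · exact (hWI k).symm
    · exact hWI j
    · rcases lt_trichotomy j k with h | h | h
      · exact hWW j k h
      · exact absurd (congrArg some h) hne
      · exact (hWW k j h).symm
  have hVU : ⋃ o, V o = K.ZUnionᶜ := by
    refine Subset.antisymm (iUnion_subset ?_) fun x hx => ?_
    · rintro (_ | k) x hx
      exacts [hx.2, hx.2]
    · by_cases hxI : ∀ m, x ∈ G.U m
      · exact mem_iUnion.2 ⟨none, mem_iInter.2 hxI, hx⟩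
      · classical
        have hex : ∃ m, x ∉ G.U m := not_forall.1 hxI
        have hspec := Nat.find_spec hex
        have h0 : Nat.find hex ≠ 0 := by
          intro h0
          rw [h0, G.U_zero] at hspec
          exact hspec (mem_univ x)
        obtain ⟨k, hk⟩ := Nat.exists_eq_succ_of_ne_zero h0
        rw [hk] at hspec
        refine mem_iUnion.2 ⟨some k, ⟨?_, hspec⟩, hx⟩
        exact not_not.1 (Nat.find_min hex (by omega))
  have hμ : μ = Measure.sum fun o => μ.restrict (V o) := by
    rw [← Measure.restrict_iUnion hVd hVm, hVU]
    exact (Measure.restrict_eq_self_of_ae_mem (measure_eq_zero_iff_ae_notMem.1 hZ)).symm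
  rw [hμ]
  refine K.isTransported_sum ?_
  rintro (_ | k)
  · change K.IsTransported n e (μ.restrict K.WInf)
    refine K.isTransported_of_QStar_eq he ?_
    rcases Nat.eq_zero_or_pos n with rfl | hn
    · exact K.QStar_zero _
    · exact hI n hn
  · change K.IsTransported n e (μ.restrict (K.W k))
    refine K.isTransported_restrict_W he ?_
    rcases Nat.eq_zero_or_pos k with rfl | hk
    · exact K.QStar_zero _
    · exact hW k hk

/-! ### From transport by bisections to invariance under `Q n` -/

/-- Both sides split into double sums over pairs of pieces. The bisection `e i j` moves the integral
over `x ∈ A ∩ B i` to one over `y ∈ A ∩ B j`, with factor `ρ_n(x) ρ_n(y)⁻¹`; summing this factor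
over all `x` in the class of `y` produces `ρ_n(y)⁻¹ ζ_n(y)`. -/
theorem setLIntegral_orbitSum_eq {n : ℕ} {μ : Measure X}
    (h : ∀ e, G.IsBisection n e → K.IsTransported n e μ) {A : Set X} (hA : MeasurableSet A)
    (hAU : A ⊆ G.U n) (hAinv : ∀ x y, G.relOn n x y → x ∈ A → y ∈ A)
    {g : X → ℝ≥0∞} (hg : Measurable g) :
    ∫⁻ x in A, G.orbitSum n g x ∂μ =
      ∫⁻ y in A, g y * (K.rhoExt n y)⁻¹ * K.zetaExt n y ∂μ := by
  obtain ⟨p⟩ := G.nonempty_bisectionPartition n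
  have hABm : ∀ i, MeasurableSet (A ∩ p.B i) := fun i => hA.inter (p.measurableSet_B i)
  have hABd : Pairwise (Function.onFun Disjoint fun i => A ∩ p.B i) := fun i j hij =>
    (p.disjoint_B hij).mono inter_subset_right inter_subset_right
  have hAB : A = ⋃ i, A ∩ p.B i := by rw [← inter_iUnion, p.iUnion_B, inter_eq_left.2 hAU]
  have hsum : ∀ F : X → ℝ≥0∞, ∫⁻ x in A, F x ∂μ = ∑' i, ∫⁻ x in A ∩ p.B i, F x ∂μ := by
    intro F
    conv_lhs => rw [hAB]
    exact lintegral_iUnion hABm hABd F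
  have hmeas : ∀ i j {F : X → ℝ≥0∞}, Measurable F →
      Measurable ((p.e i j).source.indicator fun x => (p.B j).indicator F (p.e i j x)) :=
    fun i j F hF => measurable_indicator_source_comp _ (hF.indicator (p.measurableSet_B j))
  have hleft : ∫⁻ x in A, G.orbitSum n g x ∂μ = ∑' i, ∑' j, ∫⁻ x in A ∩ p.B i,
      (p.e i j).source.indicator (fun x => (p.B j).indicator g (p.e i j x)) x ∂μ := by
    rw [hsum]
    refine tsum_congr fun i => ?_
    rw [← lintegral_tsum fun j => (hmeas i j hg).aemeasurable]
    exact setLIntegral_congr_fun (hABm i) fun x hx => p.orbitSum_eq g hx.2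
  have hright : ∫⁻ y in A, g y * (K.rhoExt n y)⁻¹ * K.zetaExt n y ∂μ =
      ∑' j, ∑' i, ∫⁻ y in A ∩ p.B j, g y * (K.rhoExt n y)⁻¹ * (p.e j i).source.indicator
        (fun y => (p.B i).indicator (K.rhoExt n) (p.e j i y)) y ∂μ := by
    rw [hsum]
    refine tsum_congr fun j => ?_
    have hm : ∀ i, Measurable fun y => g y * (K.rhoExt n y)⁻¹ * (p.e j i).source.indicator
        (fun y => (p.B i).indicator (K.rhoExt n) (p.e j i y)) y := fun i =>
      (hg.mul (K.measurable_rhoExt n).inv).mul (hmeas j i (K.measurable_rhoExt n))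
    rw [← lintegral_tsum fun i => (hm i).aemeasurable]
    refine setLIntegral_congr_fun (hABm j) fun y hy => ?_
    rw [zetaExt, p.orbitSum_eq _ hy.2, ENNReal.tsum_mul_left]
  rw [hleft, hright, ENNReal.tsum_comm]
  refine tsum_congr fun j => tsum_congr fun i => ?_
  set e := p.e i j with he_def
  have he : G.IsBisection n e := p.isBisection_e i j
  rw [← p.symm_e i j, ← he_def]
  change _ = ∫⁻ y in A ∩ p.B j, g y * (K.rhoExt n y)⁻¹ * e.target.indicator
        (fun y => (p.B i).indicator (K.rhoExt n) (e.symm y)) y ∂μ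
  obtain ⟨f, hf, hfe⟩ := e.symm.exists_measurable_eqOn_source
  have hfe' : ∀ x ∈ e.source, f (e x) = x := fun x hx => by
    rw [hfe (e.map_source hx), e.left_inv hx]
  -- `f` is a measurable stand-in for `e.symm`, so `F (e x)` restricts `x` to `A ∩ B i` and `e x` to
  -- `B j`.
  let F : X → ℝ≥0∞ := fun y => (A ∩ p.B i).indicator 1 (f y) * (p.B j).indicator g y
  have hF : Measurable F :=
    ((measurable_one.indicator (hABm i)).comp hf).mul (hg.indicator (p.measurableSet_B j))
  have key := (h e he).lintegral_eq (hF.aemeasurable (μ := μ.restrict e.target))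
  rw [← lintegral_indicator e.open_source.measurableSet,
    ← lintegral_indicator e.open_target.measurableSet] at key
  rw [← lintegral_indicator (hABm i), ← lintegral_indicator (hABm j)]
  refine Eq.trans (lintegral_congr fun x => ?_) (key.trans (lintegral_congr fun y => ?_))
  · by_cases hx : x ∈ e.source
    · rw [indicator_of_mem hx]
      change _ = (A ∩ p.B i).indicator 1 (f (e x)) * (p.B j).indicator g (e x)
      rw [hfe' x hx]
      by_cases hxA : x ∈ A ∩ p.B i
      · simp [indicator_of_mem hxA, indicator_of_mem hx]
      · simp [indicator_of_notMem hxA]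
    · rw [indicator_of_notMem hx]
      by_cases hxA : x ∈ A ∩ p.B i
      · rw [indicator_of_mem hxA, indicator_of_notMem hx]
      · rw [indicator_of_notMem hxA]
  · by_cases hy : y ∈ e.target
    · have hfy : f y = e.symm y := hfe hy
      have hr : G.relOn n (e.symm y) y := by
        simpa only [e.right_inv hy] using he _ (e.map_target hy)
      -- Saturation of `A` turns the constraint on `x` into one on `y`.
      have hAiff : e.symm y ∈ A ↔ y ∈ A := ⟨hAinv _ _ hr, hAinv _ _ (G.relOn_symm hr)⟩
      rw [indicator_of_mem hy]
      change K.density n e y * ((A ∩ p.B i).indicator 1 (f y) * (p.B j).indicator g y) = _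
      rw [hfy, density_eq]
      by_cases hyj : y ∈ p.B j <;> by_cases hyA : y ∈ A <;>
        by_cases hyi : e.symm y ∈ p.B i <;> simp [hyj, hyA, hyi, hAiff, hy]
      ring
    · rw [indicator_of_notMem hy]
      by_cases hyA : y ∈ A ∩ p.B j
      · rw [indicator_of_mem hyA, indicator_of_notMem hy, mul_zero]
      · rw [indicator_of_notMem hyA]

/-- With `A = Z_n` and `g = 1_V`, the orbit sum is at most `1` because `V` meets each class at most
once, so the left side is at most `μ(A) < ∞`; the right side is `∞ * μ(A ∩ V)`. Hence `Z_n` is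
locally null. -/
theorem measure_ZUnion_eq_zero {μ : Measure X} [IsFiniteMeasure μ]
    (h : ∀ n e, G.IsBisection n e → K.IsTransported n e μ) : μ K.ZUnion = 0 := by
  refine measure_iUnion_null fun n => ?_
  rw [Z_eq]
  set A := {x | K.zetaExt n x = ∞} with hA_def
  have hA : MeasurableSet A := K.measurable_zetaExt n (measurableSet_singleton ∞)
  have hAU : A ⊆ G.U n := by
    intro x hx
    by_contra hxn
    have hx' : K.zetaExt n x = ∞ := hx
    rw [zetaExt, G.orbitSum_of_notMem _ hxn] at hx'
    simp at hx'
  have hAinv : ∀ x y, G.relOn n x y → x ∈ A → y ∈ A := by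
    intro x y hxy hx
    have hx' : K.zetaExt n x = ∞ := hx
    change K.zetaExt n y = ∞
    rwa [← K.zetaExt_eq_of_relOn hxy]
  refine measure_null_of_locally_null _ fun x hx => ?_
  obtain ⟨V, hVo, hxV, hVU, hV⟩ := G.exists_relOn_injective_nhds (hAU hx)
  refine ⟨A ∩ V, inter_mem_nhdsWithin _ (hVo.mem_nhds hxV), ?_⟩
  have key := K.setLIntegral_orbitSum_eq (h n) hA hAU hAinv
    (g := V.indicator 1) (measurable_one.indicator hVo.measurableSet)
  have hle : ∀ y, G.orbitSum n (V.indicator 1) y ≤ 1 := by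
    intro y
    unfold orbitSum
    by_cases hy : ∃ z : {z : X // G.relOn n y z}, (z : X) ∈ V
    · obtain ⟨z, hz⟩ := hy
      rw [tsum_eq_single z]
      · rw [indicator_of_mem hz]
        exact le_rfl
      · intro w hw
        refine indicator_of_notMem (fun hwV => hw ?_) _
        exact Subtype.ext (hV _ hwV _ hz (G.relOn_trans (G.relOn_symm w.2) z.2))
    · push Not at hy
      rw [ENNReal.tsum_eq_zero.2 fun z => indicator_of_notMem (hy z) _]
      exact zero_le_one
  have hfin : ∫⁻ x in A, G.orbitSum n (V.indicator 1) x ∂μ ≠ ∞ := by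
    refine ne_top_of_le_ne_top (measure_ne_top μ A) ?_
    calc ∫⁻ x in A, G.orbitSum n (V.indicator 1) x ∂μ ≤ ∫⁻ _ in A, 1 ∂μ := lintegral_mono hle
      _ = μ A := setLIntegral_one A
  have hval : ∫⁻ y in A, V.indicator 1 y * (K.rhoExt n y)⁻¹ * K.zetaExt n y ∂μ =
      ∞ * μ (A ∩ V) := by
    have : ∀ y ∈ A, V.indicator 1 y * (K.rhoExt n y)⁻¹ * K.zetaExt n y =
        V.indicator (fun _ => (∞ : ℝ≥0∞)) y := by
      intro y hy
      have hy' : K.zetaExt n y = ∞ := hy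
      by_cases hyV : y ∈ V
      · rw [indicator_of_mem hyV, indicator_of_mem hyV, hy', Pi.one_apply, one_mul,
          ENNReal.mul_top (ENNReal.inv_ne_zero.2 (K.rhoExt_ne_top n y))]
      · simp [hyV]
    rw [setLIntegral_congr_fun hA this, lintegral_indicator_const hVo.measurableSet,
      Measure.restrict_apply hVo.measurableSet, inter_comm]
  rw [key, hval] at hfin
  by_contra h0
  exact hfin (ENNReal.top_mul h0)

/-- The orbit sum identity is applied to `f ρ_n ζ_n⁻¹`; off `Z` the value of `ζ_n` is finite and
nonzero, so the weights cancel. -/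
theorem QStar_restrict_eq {n : ℕ} {μ : Measure X}
    (h : ∀ e, G.IsBisection n e → K.IsTransported n e μ) {A : Set X} (hA : MeasurableSet A)
    (hAU : A ⊆ G.U n) (hAinv : ∀ x y, G.relOn n x y → x ∈ A → y ∈ A)
    (hAZ : ∀ x ∈ A, x ∉ K.ZUnion) : K.QStar n (μ.restrict A) = μ.restrict A := by
  refine Measure.ext_of_lintegral _ fun f hf => ?_
  have hm : Measurable fun y => f y * K.rhoExt n y * (K.zetaExt n y)⁻¹ :=
    (hf.mul (K.measurable_rhoExt n)).mul (K.measurable_zetaExt n).inv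
  rw [K.lintegral_QStar n _ hf, lintegral_congr (K.Q_eq_orbitSum n f),
    K.setLIntegral_orbitSum_eq h hA hAU hAinv hm]
  refine setLIntegral_congr_fun hA fun x hx => ?_
  have h0 := K.zetaExt_ne_zero (hAU hx)
  have h1 : K.zetaExt n x ≠ ∞ := fun h => hAZ x hx (K.mem_ZUnion.2 ⟨n, h⟩)
  change f x * K.rhoExt n x * (K.zetaExt n x)⁻¹ * (K.rhoExt n x)⁻¹ * K.zetaExt n x = f x
  rw [mul_right_comm (f x * K.rhoExt n x), mul_assoc (f x),
    ENNReal.mul_inv_cancel (K.rhoExt_ne_zero n x) (K.rhoExt_ne_top n x), mul_one, mul_assoc,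
    ENNReal.inv_mul_cancel h0 h1, mul_one]

theorem isTransported_iff_conditions {μ : Measure X} [IsFiniteMeasure μ] :
    (∀ n e, G.IsBisection n e → K.IsTransported n e μ) ↔
      (μ K.ZUnion = 0 ∧
        (∀ k : ℕ, 1 ≤ k → K.QStar k (μ.restrict (K.W k)) = μ.restrict (K.W k)) ∧
        (∀ i : ℕ, 1 ≤ i → K.QStar i (μ.restrict K.WInf) = μ.restrict K.WInf)) := by
  refine ⟨fun h => ⟨K.measure_ZUnion_eq_zero h, fun k _ => ?_, fun i _ => ?_⟩,
    fun ⟨hZ, hW, hI⟩ n e he => K.isTransported_of_conditions hZ hW hI he⟩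
  · exact K.QStar_restrict_eq (h k) (K.measurableSet_W k) (fun x hx => hx.1.1)
      (fun x y => K.mem_W_of_relOn) fun x hx => hx.2
  · exact K.QStar_restrict_eq (h i) K.measurableSet_WInf (fun x hx => mem_iInter.1 hx.1 i)
      (fun x y => K.mem_WInf_of_relOn) fun x hx => hx.2

end Potential

end GAP

namespace GAP

variable {X : Type*} [TopologicalSpace X] {G : GAP X}

/-! ### The inductive limit topology -/

theorem isOpen_groupoid_iff {s : Set G.Groupoid} :
    IsOpen s ↔ ∀ n, IsOpen (G.inclusion n ⁻¹' s) := by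
  rw [isOpen_iSup_iff]
  exact forall_congr' fun n => isOpen_coinduced

theorem continuous_groupoid_dom {Y : Type*} [TopologicalSpace Y] {f : G.Groupoid → Y} :
    Continuous f ↔ ∀ n, Continuous (f ∘ G.inclusion n) := by
  rw [continuous_iSup_dom]
  exact forall_congr' fun n => continuous_coinduced_dom

theorem continuous_inclusion (n : ℕ) : Continuous (G.inclusion n) :=
  continuous_groupoid_dom.1 continuous_id n

theorem Groupoid.continuous_val : Continuous (fun γ : G.Groupoid => γ.1) :=
  continuous_groupoid_dom.2 fun _ => continuous_subtype_val

theorem Groupoid.continuous_source : Continuous (Groupoid.source : G.Groupoid → X) :=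
  continuous_snd.comp continuous_val

instance [T2Space X] : T2Space G.Groupoid :=
  T2Space.of_injective_continuous Subtype.val_injective Groupoid.continuous_val

instance : MeasurableSpace G.Groupoid := borel _

instance : BorelSpace G.Groupoid := ⟨rfl⟩

/-- The graph of an open partial homeomorphism, as a subset of `R`. -/
def graph (G : GAP X) (e : OpenPartialHomeomorph X X) : Set G.Groupoid :=
  {γ | γ.range ∈ e.source ∧ e γ.range = γ.source}

/-- Openness has to be checked in every `R m`, not only for `m = n`. A pair `(x', y') ∈ R m` near
`(x, e x)` has `e x'` and `y'` both in `V`; they are equivalent at level `max n m`, where `V` meets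
classes only once, hence equal. -/
theorem isOpen_graph {n : ℕ} {e : OpenPartialHomeomorph X X} (he : G.IsBisection n e) :
    IsOpen (G.graph e) := by
  refine isOpen_groupoid_iff.2 fun m => isOpen_iff_mem_nhds.2 ?_
  rintro ⟨⟨x, y⟩, hxy⟩ ⟨hx : x ∈ e.source, rfl : e x = y⟩
  have hfst : Continuous fun p : {p : X × X // G.relOn m p.1 p.2} => p.1.1 :=
    continuous_fst.comp continuous_subtype_val
  have hsnd : Continuous fun p : {p : X × X // G.relOn m p.1 p.2} => p.1.2 :=
    continuous_snd.comp continuous_subtype_val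
  have hn := he x hx
  change G.relOn m x (e x) at hxy
  obtain ⟨V, hVo, hyV, hVU, hV⟩ :=
    G.exists_relOn_injective_nhds (n := max n m) (x := e x) (by
      rcases le_total n m with h | h
      · rw [max_eq_right h]
        exact hxy.2.1
      · rw [max_eq_left h]
        exact hn.2.1)
  have h1 : ∀ᶠ p : {p : X × X // G.relOn m p.1 p.2} in 𝓝 ⟨⟨x, e x⟩, hxy⟩,
      p.1.1 ∈ e.source ∩ e ⁻¹' V :=
    hfst.continuousAt.eventually_mem
      ((e.isOpen_inter_preimage hVo).mem_nhds (show x ∈ e.source ∩ e ⁻¹' V from ⟨hx, hyV⟩))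
  have h2 : ∀ᶠ p : {p : X × X // G.relOn m p.1 p.2} in 𝓝 ⟨⟨x, e x⟩, hxy⟩, p.1.2 ∈ V :=
    hsnd.continuousAt.eventually_mem (hVo.mem_nhds (show e x ∈ V from hyV))
  filter_upwards [h1, h2] with p hp1 hp2
  exact ⟨hp1.1, hV _ hp1.2 _ hp2 (G.relOn_trans
    (G.relOn_symm (G.relOn_of_le (le_max_left n m) (he _ hp1.1) (hVU hp1.2)))
    (G.relOn_of_le (le_max_right n m) p.2 (hVU hp2)))⟩

/-- The section `y ↦ (e⁻¹(y), y)` of the source map given by a bisection. -/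
def IsBisection.sourceSection {n : ℕ} {e : OpenPartialHomeomorph X X} (he : G.IsBisection n e)
    (y : e.target) : G.Groupoid :=
  ⟨(e.symm y, y), n, by simpa only [e.right_inv y.2] using he _ (e.map_target y.2)⟩

theorem IsBisection.continuous_sourceSection {n : ℕ} {e : OpenPartialHomeomorph X X}
    (he : G.IsBisection n e) : Continuous he.sourceSection := by
  refine (continuous_inclusion (G := G) n).comp
    (f := fun y : e.target => ⟨(e.symm y, y), by
      simpa only [e.right_inv y.2] using he _ (e.map_target y.2)⟩) ?_
  refine Continuous.subtype_mk (Continuous.prodMk ?_ continuous_subtype_val) _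
  exact continuousOn_iff_continuous_domRestrict.1 e.continuousOn_symm

theorem IsBisection.eq_sourceSection {n : ℕ} {e : OpenPartialHomeomorph X X}
    (he : G.IsBisection n e) {γ : G.Groupoid} (hγ : γ ∈ G.graph e) :
    ∃ h : γ.source ∈ e.target, γ = he.sourceSection ⟨γ.source, h⟩ := by
  obtain ⟨h1, h2⟩ := hγ
  refine ⟨h2 ▸ e.map_source h1, Subtype.ext (Prod.ext ?_ rfl)⟩
  change γ.range = e.symm γ.source
  rw [← h2, e.left_inv h1]

theorem IsBisection.relOn_symm_apply {n : ℕ} {e : OpenPartialHomeomorph X X}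
    (he : G.IsBisection n e) {y : X} (hy : y ∈ e.target) : G.relOn n (e.symm y) y := by
  simpa only [e.right_inv hy] using he _ (e.map_target hy)

/-! ### Sums over the fibres of the range and source maps -/

section Fibers

variable {n : ℕ} {e : OpenPartialHomeomorph X X} (he : G.IsBisection n e) {f : G.Groupoid → ℂ}
  {F : X → ℂ}

/-- The graph meets the fibre over `x` in at most the point `(x, e x)`. The values of `F` off
`e.target` play no role. -/
theorem IsBisection.hasSum_range (hf : ∀ γ ∉ G.graph e, f γ = 0)
    (hF : ∀ y : e.target, F y = f (he.sourceSection y)) (x : X) :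
    HasSum (fun γ : {γ : G.Groupoid // γ.range = x} => f γ)
      (e.source.indicator (fun x => F (e x)) x) := by
  by_cases hx : x ∈ e.source
  · have hs : (he.sourceSection ⟨e x, e.map_source hx⟩).range = x := e.left_inv hx
    rw [indicator_of_mem hx, hF ⟨e x, e.map_source hx⟩]
    refine hasSum_single (⟨_, hs⟩ : {γ : G.Groupoid // γ.range = x}) ?_
    rintro ⟨γ, hγ⟩ hne
    refine hf γ fun hγe => hne (Subtype.ext (Subtype.ext (Prod.ext ?_ ?_)))
    · exact hγ.trans hs.symm
    · change γ.source = e x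
      rw [← hγe.2, hγ]
  · rw [indicator_of_notMem hx]
    have : (fun γ : {γ : G.Groupoid // γ.range = x} => f γ) = fun _ => 0 := by
      funext γ
      exact hf γ fun hγe => hx (γ.2 ▸ hγe.1)
    rw [this]
    exact hasSum_zero

theorem IsBisection.hasSum_source (K : G.Potential) (hf : ∀ γ ∉ G.graph e, f γ = 0)
    (hF : ∀ y : e.target, F y = f (he.sourceSection y)) (y : X) :
    HasSum (fun γ : {γ : G.Groupoid // γ.source = y} => f γ * (K.D γ : ℂ))
      (e.target.indicator (fun y => (K.density n e y).toReal • F y) y) := by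
  by_cases hy : y ∈ e.target
  · have hD : K.D (he.sourceSection ⟨y, hy⟩) = (K.density n e y).toReal := by
      rw [K.D_eq _ (he.relOn_symm_apply hy), Potential.density,
        ENNReal.toReal_ofReal (Real.exp_pos _).le]
      rfl
    rw [indicator_of_mem hy, hF ⟨y, hy⟩, ← hD, Complex.real_smul, mul_comm]
    refine hasSum_single (⟨he.sourceSection ⟨y, hy⟩, rfl⟩ : {γ : G.Groupoid // γ.source = y}) ?_
    rintro ⟨γ, hγ⟩ hne
    rw [hf γ, zero_mul]
    intro hγe
    obtain ⟨h, hs⟩ := he.eq_sourceSection hγe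
    refine hne (Subtype.ext (hs.trans ?_))
    subst hγ
    rfl
  · rw [indicator_of_notMem hy]
    have : (fun γ : {γ : G.Groupoid // γ.source = y} => f γ * (K.D γ : ℂ)) = fun _ => 0 := by
      funext γ
      rw [hf γ, zero_mul]
      intro hγe
      obtain ⟨h, _⟩ := he.eq_sourceSection hγe
      exact hy (γ.2 ▸ h)
    rw [this]
    exact hasSum_zero

end Fibers

/-- On the open graph the extension is `φ` composed with the source map. Off the graph it vanishes
near each point, because the image of the support of `φ` is compact, hence closed in the Hausdorff
space `R`. -/
theorem exists_continuous_extension [T2Space X] {n : ℕ} {e : OpenPartialHomeomorph X X}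
    (he : G.IsBisection n e) {φ : e.target → ℂ} (hφ : Continuous φ) (hφs : HasCompactSupport φ) :
    ∃ f : G.Groupoid → ℂ, Continuous f ∧ HasCompactSupport f ∧ (∀ γ ∉ G.graph e, f γ = 0) ∧
      ∀ y, f (he.sourceSection y) = φ y := by
  classical
  let f : G.Groupoid → ℂ := fun γ =>
    if h : γ ∈ G.graph e then φ ⟨γ.source, (he.eq_sourceSection h).1⟩ else 0
  have hmem : ∀ y, he.sourceSection y ∈ G.graph e := fun y =>
    ⟨e.map_target y.2, e.right_inv y.2⟩
  have hf1 : ∀ y, f (he.sourceSection y) = φ y := fun y => dif_pos (hmem y)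
  have hcomp : IsCompact (he.sourceSection '' tsupport φ) :=
    hφs.isCompact.image he.continuous_sourceSection
  have hf0 : ∀ γ ∉ he.sourceSection '' tsupport φ, f γ = 0 := by
    intro γ hγ
    by_cases hγe : γ ∈ G.graph e
    · obtain ⟨h, hs⟩ := he.eq_sourceSection hγe
      rw [hs, hf1]
      refine image_eq_zero_of_notMem_tsupport fun h' => hγ ?_
      exact ⟨_, h', hs.symm⟩
    · exact dif_neg hγe
  refine ⟨f, continuous_iff_continuousAt.2 fun γ => ?_, HasCompactSupport.intro hcomp hf0,
    fun γ hγ => dif_neg hγ, hf1⟩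
  by_cases hγe : γ ∈ G.graph e
  · refine ContinuousOn.continuousAt ?_ ((isOpen_graph he).mem_nhds hγe)
    rw [continuousOn_iff_continuous_domRestrict]
    have : (G.graph e).domRestrict f =
        fun γ : G.graph e => φ ⟨γ.1.source, (he.eq_sourceSection γ.2).1⟩ :=
      funext fun γ => dif_pos γ.2
    rw [this]
    exact hφ.comp
      ((Groupoid.continuous_source.comp continuous_subtype_val).subtype_mk _)
  · have hnot : γ ∈ (he.sourceSection '' tsupport φ)ᶜ := by
      rintro ⟨y, _, rfl⟩
      exact hγe (hmem y)
    refine (continuousAt_const (y := (0 : ℂ))).congr ?_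
    filter_upwards [hcomp.isClosed.isOpen_compl.mem_nhds hnot] with γ' hγ'
    exact (hf0 γ' hγ').symm

/-! ### Quasi-invariance in terms of bisections -/

namespace Potential

variable (K : G.Potential)

theorem continuous_exp_hExt_sub {n : ℕ} {e : OpenPartialHomeomorph X X}
    (he : G.IsBisection n e) :
    Continuous fun y : e.target => Real.exp (K.hExt n (e.symm y) - K.hExt n y) := by
  have h1 : Continuous fun y : e.target => K.h n ⟨e.symm y, (he.relOn_symm_apply y.2).1⟩ :=
    (K.continuous_h n).comp
      ((continuousOn_iff_continuous_domRestrict.1 e.continuousOn_symm).subtype_mk _)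
  have h2 : Continuous fun y : e.target => K.h n ⟨y, (he.relOn_symm_apply y.2).2.1⟩ :=
    (K.continuous_h n).comp (continuous_subtype_val.subtype_mk _)
  refine Real.continuous_exp.comp ((h1.sub h2).congr fun y => ?_)
  rw [K.hExt_of_mem (he.relOn_symm_apply y.2).1, K.hExt_of_mem (he.relOn_symm_apply y.2).2.1]
  rfl

variable [MeasurableSpace X]

/-- Both sides of the quasi-invariance identity for `f` are meaningful, and they agree. -/
structure IsBalanced (μ : Measure X) (f : G.Groupoid → ℂ) : Prop where
  summable_range : ∀ x, Summable fun γ : {γ : G.Groupoid // γ.range = x} => f γ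
  summable_source : ∀ y, Summable fun γ : {γ : G.Groupoid // γ.source = y} => f γ * (K.D γ : ℂ)
  integrable_range : Integrable (fun x => ∑' γ : {γ : G.Groupoid // γ.range = x}, f γ) μ
  integrable_source :
    Integrable (fun y => ∑' γ : {γ : G.Groupoid // γ.source = y}, f γ * (K.D γ : ℂ)) μ
  integral_eq : ∫ x, ∑' γ : {γ : G.Groupoid // γ.range = x}, f γ ∂μ =
      ∫ x, ∑' γ : {γ : G.Groupoid // γ.source = x}, f γ * (K.D γ : ℂ) ∂μ

variable {K}

/-- Additivity of `∑'` and of the integral uses summability and integrability, which is why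
`IsBalanced` records them besides the identity itself. -/
theorem IsBalanced.add {μ : Measure X} {f g : G.Groupoid → ℂ} (hf : K.IsBalanced μ f)
    (hg : K.IsBalanced μ g) : K.IsBalanced μ (fun γ => f γ + g γ) := by
  have hr : (fun x => ∑' γ : {γ : G.Groupoid // γ.range = x}, (f γ + g γ)) = fun x =>
      ∑' γ : {γ : G.Groupoid // γ.range = x}, f γ +
        ∑' γ : {γ : G.Groupoid // γ.range = x}, g γ :=
    funext fun x => (hf.summable_range x).tsum_add (hg.summable_range x)
  have hs : (fun y => ∑' γ : {γ : G.Groupoid // γ.source = y}, (f γ + g γ) * (K.D γ : ℂ)) =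
      fun y => ∑' γ : {γ : G.Groupoid // γ.source = y}, f γ * (K.D γ : ℂ) +
        ∑' γ : {γ : G.Groupoid // γ.source = y}, g γ * (K.D γ : ℂ) := by
    funext y
    simp_rw [add_mul]
    exact (hf.summable_source y).tsum_add (hg.summable_source y)
  refine ⟨fun x => (hf.summable_range x).add (hg.summable_range x), fun y => ?_, ?_, ?_, ?_⟩
  · simp_rw [add_mul]
    exact (hf.summable_source y).add (hg.summable_source y)
  · rw [hr]
    exact hf.integrable_range.add hg.integrable_range
  · rw [hs]
    exact hf.integrable_source.add hg.integrable_source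
  · rw [hr, hs, integral_add hf.integrable_range hg.integrable_range,
      integral_add hf.integrable_source hg.integrable_source, hf.integral_eq, hg.integral_eq]

theorem isBalanced_zero (μ : Measure X) : K.IsBalanced μ fun _ => 0 := by
  constructor <;> simp [summable_zero]

/-- Functions are cut by indicators of the sets `S i` instead of a partition of unity. This destroys
continuity, so the induction runs over bounded Borel functions. -/
theorem isBalanced_of_support_subset_iUnion {ι : Type*} {μ : Measure X} {S : ι → Set G.Groupoid}
    (hSm : ∀ i, MeasurableSet (S i))
    (hS : ∀ i (f : G.Groupoid → ℂ) (C : ℝ), Measurable f → (∀ γ, ‖f γ‖ ≤ C) →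
      (∀ γ ∉ S i, f γ = 0) → K.IsBalanced μ f) (t : Finset ι) :
    ∀ (f : G.Groupoid → ℂ) (C : ℝ), Measurable f → (∀ γ, ‖f γ‖ ≤ C) →
      (∀ γ ∉ ⋃ i ∈ t, S i, f γ = 0) → K.IsBalanced μ f := by
  classical
  induction t using Finset.induction_on with
  | empty =>
    intro f C _ _ hf
    have : f = fun _ => 0 := funext fun γ => hf γ (by simp)
    rw [this]
    exact isBalanced_zero μ
  | insert i t _ ih =>
    intro f C hfm hC hf
    have hsplit : f = fun γ => (S i).indicator f γ + (S i)ᶜ.indicator f γ :=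
      (indicator_self_add_compl (S i) f).symm
    have hCi : ∀ (s : Set G.Groupoid) γ, ‖s.indicator f γ‖ ≤ C := fun s γ =>
      (norm_indicator_le_norm_self f γ).trans (hC γ)
    rw [hsplit]
    refine IsBalanced.add (hS i _ C (hfm.indicator (hSm i)) (hCi _) fun γ hγ =>
      indicator_of_notMem hγ _) (ih _ C (hfm.indicator (hSm i).compl) (hCi _) fun γ hγ => ?_)
    by_cases hγi : γ ∈ S i
    · exact indicator_of_notMem (notMem_compl_iff.2 hγi) _
    · rw [indicator_of_mem (show γ ∈ (S i)ᶜ from hγi)]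
      refine hf γ fun h => ?_
      rw [Finset.set_biUnion_insert] at h
      exact h.elim hγi hγ

variable [BorelSpace X]

theorem IsTransported.isBalanced {μ : Measure X} [IsFiniteMeasure μ] {n : ℕ}
    {e : OpenPartialHomeomorph X X} (h : K.IsTransported n e μ) (he : G.IsBisection n e)
    {f : G.Groupoid → ℂ} (hfm : Measurable f) {C : ℝ} (hC : ∀ γ, ‖f γ‖ ≤ C)
    (hf : ∀ γ ∉ G.graph e, f γ = 0) : K.IsBalanced μ f := by
  classical
  let F : X → ℂ := fun y => if hy : y ∈ e.target then f (he.sourceSection ⟨y, hy⟩) else 0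
  have hF : ∀ y : e.target, F y = f (he.sourceSection y) := fun y => dif_pos y.2
  have hFm : Measurable F :=
    Measurable.dite (s := e.target) (hfm.comp he.continuous_sourceSection.measurable)
      measurable_const e.open_target.measurableSet
  have hFC : ∀ y, ‖F y‖ ≤ max C 0 := by
    intro y
    by_cases hy : y ∈ e.target
    · rw [hF ⟨y, hy⟩]
      exact (hC _).trans (le_max_left _ _)
    · change ‖dite _ _ _‖ ≤ _
      rw [dif_neg hy, norm_zero]
      exact le_max_right _ _
  have hr : (fun x => ∑' γ : {γ : G.Groupoid // γ.range = x}, f γ) =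
      e.source.indicator fun x => F (e x) := funext fun x => (he.hasSum_range hf hF x).tsum_eq
  have hs : (fun y => ∑' γ : {γ : G.Groupoid // γ.source = y}, f γ * (K.D γ : ℂ)) =
      e.target.indicator fun y => (K.density n e y).toReal • F y :=
    funext fun y => (he.hasSum_source K hf hF y).tsum_eq
  have hae := e.aemeasurable_restrict_source μ
  have hfin : ∀ᵐ y ∂μ.restrict e.target, K.density n e y < ∞ :=
    Filter.Eventually.of_forall fun y => ENNReal.ofReal_lt_top
  have hint : Integrable F (Measure.map e (μ.restrict e.source)) :=
    Integrable.of_bound hFm.aestronglyMeasurable _ (Filter.Eventually.of_forall hFC)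
  -- The density may be unbounded on the target; integrability there is inherited from the bounded
  -- function `F` on the finite transported measure.
  have hint' := hint
  rw [show Measure.map e (μ.restrict e.source) = _ from h,
    integrable_withDensity_iff_integrable_smul₀' (K.aemeasurable_density n e μ) hfin] at hint'
  refine ⟨fun x => (he.hasSum_range hf hF x).summable,
    fun y => (he.hasSum_source K hf hF y).summable, ?_, ?_, ?_⟩
  · rw [hr, integrable_indicator_iff e.open_source.measurableSet]
    exact hint.comp_aemeasurable hae
  · rw [hs, integrable_indicator_iff e.open_target.measurableSet]
    exact hint'
  · rw [hr, hs, integral_indicator e.open_source.measurableSet,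
      integral_indicator e.open_target.measurableSet,
      ← integral_map hae hFm.aestronglyMeasurable, show Measure.map e (μ.restrict e.source) = _
        from h, integral_withDensity_eq_integral_toReal_smul₀ (K.aemeasurable_density n e μ) hfin]

theorem isQuasiInvariant_of_isTransported {μ : Measure X} [IsFiniteMeasure μ]
    (h : ∀ n e, G.IsBisection n e → K.IsTransported n e μ) : K.IsQuasiInvariant μ := by
  intro f hfc hfs
  choose n hn using fun γ : G.Groupoid => γ.2
  choose e he hxe hye using fun γ : G.Groupoid => G.exists_isBisection (hn γ)
  obtain ⟨t, ht⟩ := hfs.isCompact.elim_finite_subcover (fun γ => G.graph (e γ))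
    (fun γ => isOpen_graph (he γ)) fun γ _ => mem_iUnion.2 ⟨γ, hxe γ, hye γ⟩
  obtain ⟨C, hC⟩ := hfs.exists_bound_of_continuous hfc
  refine (isBalanced_of_support_subset_iUnion (K := K) (μ := μ)
    (fun γ => (isOpen_graph (he γ)).measurableSet) (fun γ g C' hg hC' hgs => ?_) t f C
    hfc.measurable hC fun γ hγ => ?_).integral_eq
  · exact (h _ _ (he γ)).isBalanced (he γ) hg hC' hgs
  · exact image_eq_zero_of_notMem_tsupport fun hγ' => hγ (ht hγ')

/-- The two measures are compared on the locally compact space `e.target`, where integrals of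
compactly supported continuous functions determine them. -/
theorem IsQuasiInvariant.isTransported [LocallyCompactSpace X] [SecondCountableTopology X]
    [T2Space X] {μ : Measure X} [IsFiniteMeasure μ]
    (h : K.IsQuasiInvariant μ) {n : ℕ} {e : OpenPartialHomeomorph X X}
    (he : G.IsBisection n e) : K.IsTransported n e μ := by
  have hsm := e.open_source.measurableSet
  have htm := e.open_target.measurableSet
  have : LocallyCompactSpace e.target := e.open_target.locallyCompactSpace
  let d : e.target → NNReal :=
    fun y => (Real.exp (K.hExt n (e.symm y) - K.hExt n y)).toNNReal
  have hd : Continuous d := continuous_real_toNNReal.comp (K.continuous_exp_hExt_sub he)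
  let ψ : e.source → e.target := e.toHomeomorphSourceTarget
  have hψ : Measurable ψ := e.toHomeomorphSourceTarget.continuous.measurable
  let μs : Measure e.source := Measure.comap Subtype.val μ
  let μt : Measure e.target := Measure.comap Subtype.val μ
  have : IsFiniteMeasure μs := by infer_instance
  have : IsFiniteMeasure μt := by infer_instance
  let m₁ : Measure e.target := Measure.map ψ μs
  let m₂ : Measure e.target := μt.withDensity fun y => d y
  -- `m₂` may be infinite, but the continuous density `d` is locally bounded.
  have : IsLocallyFiniteMeasure m₂ := IsLocallyFiniteMeasure.withDensity_coe hd
  have hm : m₁ = m₂ := by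
    refine Measure.ext_of_integral_eq_on_compactlySupported fun φ => ?_
    -- The test functions `φ` are real, while quasi-invariance is stated for complex ones.
    have hφc : Continuous fun y => (φ y : ℂ) := Complex.continuous_ofReal.comp φ.continuous
    have hφs : HasCompactSupport fun y => (φ y : ℂ) :=
      φ.hasCompactSupport.comp_left (g := Complex.ofReal) Complex.ofReal_zero
    obtain ⟨f, hfc, hfs, hf0, hf⟩ := exists_continuous_extension he hφc hφs
    classical
    let F : X → ℂ := fun y => if hy : y ∈ e.target then (φ ⟨y, hy⟩ : ℂ) else 0
    have hFφ : ∀ y : e.target, F y = φ y := fun y => dif_pos y.2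
    have hF : ∀ y : e.target, F y = f (he.sourceSection y) := fun y => by rw [hf, hFφ]
    have key := h f hfc hfs
    simp only [(he.hasSum_range hf0 hF _).tsum_eq, (he.hasSum_source K hf0 hF _).tsum_eq] at key
    rw [integral_indicator hsm, integral_indicator htm, ← integral_subtype_comap hsm,
      ← integral_subtype_comap htm] at key
    have h1 : ∫ x : e.source, F (e x) ∂Measure.comap Subtype.val μ =
        ((∫ y, φ y ∂m₁ : ℝ) : ℂ) := by
      rw [← integral_complex_ofReal, integral_map hψ.aemeasurable hφc.aestronglyMeasurable]
      exact integral_congr_ae (Filter.Eventually.of_forall fun x => hFφ (ψ x))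
    have h2 : ∫ y : e.target, (K.density n e y).toReal • F y ∂Measure.comap Subtype.val μ =
        ((∫ y, φ y ∂m₂ : ℝ) : ℂ) := by
      rw [integral_withDensity_eq_integral_smul hd.measurable, ← integral_complex_ofReal]
      refine integral_congr_ae (Filter.Eventually.of_forall fun y => ?_)
      change (K.density n e y).toReal • F y = ((d y • φ y : ℝ) : ℂ)
      rw [hFφ, Complex.real_smul, ← Complex.ofReal_mul]
      rfl
    rw [h1, h2] at key
    exact Complex.ofReal_injective key
  refine isTransported_of_lintegral_eq fun g hg => ?_
  rw [← lintegral_subtype_comap hsm, ← lintegral_subtype_comap htm]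
  have hgm : Measurable fun y : e.target => g y := hg.comp measurable_subtype_coe
  calc ∫⁻ x : e.source, g (e x) ∂μs = ∫⁻ y, g y ∂m₁ := (lintegral_map hgm hψ).symm
    _ = ∫⁻ y, g y ∂m₂ := by rw [hm]
    _ = _ := lintegral_withDensity_eq_lintegral_mul _ hd.measurable.coe_nnreal_ennreal hgm

end Potential

end GAP

end

theorem theorem7p4 {X : Type*} [TopologicalSpace X] [LocallyCompactSpace X]
    [SecondCountableTopology X] [TopologicalSpace.MetrizableSpace X]
    [MeasurableSpace X] [BorelSpace X]
    (G : GAP X) (K : G.Potential) (μ : Measure X) [IsFiniteMeasure μ] :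
    K.IsQuasiInvariant μ ↔
      (μ K.ZUnion = 0 ∧
        (∀ k : ℕ, 1 ≤ k → K.QStar k (μ.restrict (K.W k)) = μ.restrict (K.W k)) ∧
        (∀ i : ℕ, 1 ≤ i → K.QStar i (μ.restrict K.WInf) = μ.restrict K.WInf)) := by
  rw [← K.isTransported_iff_conditions]
  exact ⟨fun h n e he => h.isTransported he,
    fun h => GAP.Potential.isQuasiInvariant_of_isTransported h⟩
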